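/- Let $G_{\mathbb C}$ be a complex Lie group whose (finite-dimensional) Lie algebra $\mathfrak g$ is semisimple and non-zero, with exponential map $\exp:\mathfrak g\to G_{\mathbb C}$. Let $M\mathfrak g$ and $MG$ be the spaces of holomorphic maps $\mathbb C^*\to\mathfrak g$ and $\mathbb C^*\to G_{\mathbb C}$ with the compact-open topology, and let $\mathrm{Mexp}:M\mathfrak g\to MG$, $(\mathrm{Mexp}\,X)(z)=\exp(X(z))$. A path in $M\mathfrak g$ or $MG$ is called smooth if it is jointly smooth in $(t,z)\in\mathbb R\times\mathbb C^*$, a map is called smooth if it sends smooth paths to smooth paths, and a map is a local diffeomorphism at a point if it restricts to a homeomorphism from an open neighbourhood of the point onto an open set that is smooth in both directions. Then: 1. $\mathrm{Mexp}$ is not a local diffeomorphism at $0$ (in particular, it is not a local diffeomorphism). 2. There are a subalgebra $\mathfrak h\subset\mathfrak g$ with $\mathfrak h\cong\mathfrak{sl}(2,\mathbb C)$ and loops $f_n\in MG$ with $f_n\to\mathrm{Id}$ and with values in the subgroup of $G_{\mathbb C}$ generated by $\exp(\mathfrak h)$, such that no $f_n$ lies in the image $\mathrm{Mexp}(M\mathfrak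 g)$. 3. If $\exp(\mathfrak g)$ does not contain the identity component of $G_{\mathbb C}$, then there are loops $f_n\in MG$ with $f_n\to\mathrm{Id}$, each of which takes a value outside $\exp(\mathfrak g)$. 4. There are holomorphic loops $f_n:\mathbb C^*\to SL(2,\mathbb C)$ that converge to $\mathrm{Id}$ in the compact-open topology, each of which takes a value outside $\exp(\mathfrak{sl}(2,\mathbb C))$. -/

import Mathlib

open scoped Manifold ContDiff Topology

noncomputable section

/-- Holomorphic loops `ℂ^* → N` in a complex manifold `N` modelled on `E`. Over `ℂ`, being
holomorphic is the same as being analytic (`C^ω`). For `N = E` the underlying vector space of the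
Lie algebra `𝔤` of a complex Lie group `G`, this is the loop algebra `M𝔤`; for `N = G` it is the
loop group `MG` (its pointwise group structure is Mathlib's group structure on `C^ω` maps). -/
abbrev HolLoop (E : Type*) [NormedAddCommGroup E] [NormedSpace ℂ E]
    (N : Type*) [TopologicalSpace N] [ChartedSpace E N] : Type _ :=
  ContMDiffMap 𝓘(ℂ, ℂ) 𝓘(ℂ, E) ℂˣ N ω

/-- The compact-open topology on spaces of holomorphic loops. -/
instance HolLoop.instTopologicalSpace (E : Type*) [NormedAddCommGroup E] [NormedSpace ℂ E]
    (N : Type*) [TopologicalSpace N] [ChartedSpace E N] : TopologicalSpace (HolLoop E N) :=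
  TopologicalSpace.induced
    (fun f : HolLoop E N => (⟨f, f.contMDiff.continuous⟩ : C(ℂˣ, N))) inferInstance

/-- A path of holomorphic loops is smooth if it is jointly (real) smooth in `(t, z) ∈ ℝ × ℂ^*`. -/
def HolLoop.SmoothPath {E : Type*} [NormedAddCommGroup E] [NormedSpace ℂ E]
    {N : Type*} [TopologicalSpace N] [ChartedSpace E N] (c : ℝ → HolLoop E N) : Prop :=
  ContMDiff (𝓘(ℝ, ℝ).prod 𝓘(ℝ, ℂ)) 𝓘(ℝ, E) ∞ (fun p : ℝ × ℂˣ => c p.1 p.2)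

/-- A map between spaces of loops is smooth on the (open) set `U` if it sends smooth paths in `U`
to smooth paths. On Fréchet manifolds this is the same as being smooth in the sense of
continuous directional derivatives of all orders. -/
def HolLoop.SmoothMapOn {E E' : Type*} [NormedAddCommGroup E] [NormedSpace ℂ E]
    [NormedAddCommGroup E'] [NormedSpace ℂ E']
    {N : Type*} [TopologicalSpace N] [ChartedSpace E N]
    {N' : Type*} [TopologicalSpace N'] [ChartedSpace E' N']
    (F : HolLoop E N → HolLoop E' N') (U : Set (HolLoop E N)) : Prop :=
  ∀ c : ℝ → HolLoop E N, (∀ t, c t ∈ U) → HolLoop.SmoothPath c →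
    HolLoop.SmoothPath (fun t => F (c t))

/-- `F` is a local diffeomorphism at `X`: it restricts to a homeomorphism of an open neighbourhood
of `X` onto an open set of holomorphic loops which is smooth in both directions. (`F` is given by
its values as maps `ℂ^* → N'`, the condition includes that they are holomorphic near `X`.) -/
def HolLoop.IsLocalDiffeoAt {E E' : Type*} [NormedAddCommGroup E] [NormedSpace ℂ E]
    [NormedAddCommGroup E'] [NormedSpace ℂ E']
    {N : Type*} [TopologicalSpace N] [ChartedSpace E N]
    {N' : Type*} [TopologicalSpace N'] [ChartedSpace E' N']
    (F : HolLoop E N → ℂˣ → N') (X : HolLoop E N) : Prop :=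
  ∃ e : OpenPartialHomeomorph (HolLoop E N) (HolLoop E' N'),
    X ∈ e.source ∧ (∀ Y ∈ e.source, ⇑(e Y) = F Y) ∧
      HolLoop.SmoothMapOn e e.source ∧ HolLoop.SmoothMapOn e.symm e.target

section Exponential

variable {E : Type*} [NormedAddCommGroup E] [NormedSpace ℂ E]
  {G : Type*} [TopologicalSpace G] [ChartedSpace E G] [Group G]

/-- `γ : ℂ → G` is the holomorphic one-parameter subgroup of `G` with derivative `v` at `0`. -/
structure IsOneParameterSubgroup (v : GroupLieAlgebra 𝓘(ℂ, E) G) (γ : ℂ → G) : Prop where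
  holomorphic : ContMDiff 𝓘(ℂ, ℂ) 𝓘(ℂ, E) ω γ
  map_add : ∀ s t, γ (s + t) = γ s * γ t
  deriv_zero : mfderiv 𝓘(ℂ, ℂ) 𝓘(ℂ, E) γ 0 (1 : ℂ) = (v : E)

open Classical in
/-- The exponential map `𝔤 → G` of a complex Lie group: `exp v = γ 1` for the one-parameter
subgroup `γ` with derivative `v` at `0` (which exists and is unique for every `v`). -/
def lieExp (v : GroupLieAlgebra 𝓘(ℂ, E) G) : G :=
  if h : ∃ γ : ℂ → G, IsOneParameterSubgroup v γ then h.choose 1 else 1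

/-- The pointwise exponential map `Mexp : M𝔤 → MG`, `(Mexp X)(z) = exp (X z)`. -/
def Mexp (X : HolLoop E E) : ℂˣ → G :=
  fun z => lieExp (X z : GroupLieAlgebra 𝓘(ℂ, E) G)

end Exponential

end

/-! ### Exponential identities for an `𝔰𝔩₂`-triple in a Banach algebra -/

section BanachAlgebra

open NormedSpace

variable {A : Type*} [NormedRing A] [NormedAlgebra ℂ A] [CompleteSpace A]

/-! The obstruction to a logarithm is monodromy in `z`. Take an `𝔰𝔩₂`-triple `h, e, f` in `𝔤` and
the loops `f_s(z) = exp(s e) exp(s (z - 1) f)`, with `s = 1/(n+1)`. They tend to `1` because they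
depend continuously on `(s, z)` and are trivial at `s = 0`. If `f_s = exp X(z)`, then applying `Ad`
makes `A(z) = ad X(z)` a continuous logarithm of `exp(s ad e) exp(s (z - 1) ad f)` on `ℂ^*`. So it
suffices to refute this in `End 𝔤`, for every such `G` at once; mere values outside `exp 𝔤` would
not do, since `exp` is onto for `PSL(2, ℂ)`.

Write `H = ad h`. In `SL₂` the element `f_s(z)` has trace `2 + s² (z - 1)`. Put `μ = 2 + iθ` and
choose `z(θ)` so that this trace is `e^μ + e^(-μ)`. A Gauss decomposition
(`Sl2Relations.exp_x_mul_exp_y_eq_conj`) then conjugates the loop to `exp(μ H)` by an explicit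
`g(θ)` that is `2π`-periodic, as is `z(θ)`. The conjugated logarithm `A'` satisfies `exp A' = exp(μ
H)`; since `H` has integer eigenvalues and `Re μ ≠ 0`, it commutes with `H`, and `tr(A' H) - μ
tr(H²)` lies in `2πi ℤ` (`IsIntegerDiagonalizable.endTrace_mul`). By continuity this number does not
depend on `θ`. But from `θ = 0` to `2π` the first term returns while `μ` gains `2πi`, which forces
`tr(H²) = 0`. For a coroot `h` this trace is a nonzero value of the Killing form
(`Sl2Relations.not_exists_log`, `LieAlgebra.exists_isSl2Triple_of_isSemisimple`).

Failure of local invertibility follows: a neighbourhood of `1` filled by values of `Mexp` would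
contain some `f_s`. The third claim rests on joining a point `g` of the identity component to `1` by
an entire curve `F` and rescaling to `F(z/(n+1))`. The fourth is the explicit matrix loop, evaluated
where its trace is `-2`.

The Lie group input, namely existence and uniqueness of holomorphic one-parameter subgroups and
`Ad(exp v) = exp(ad v)`, is obtained in the chart at `1` from logarithmic derivatives, with `ad`
read off from the second derivative of the multiplication. -/

theorem hasDerivAt_exp_smul_comp {c : ℂ → ℂ} {c' : ℂ} {t : ℂ} (hc : HasDerivAt c c' t) (X : A) :
    HasDerivAt (fun s => exp (c s • X)) (c' • (exp (c t • X) * X)) t :=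
  (hasDerivAt_exp_smul_const (𝕂 := ℂ) X (c t)).scomp t hc

theorem hasDerivAt_exp_smul_comp' {c : ℂ → ℂ} {c' : ℂ} {t : ℂ} (hc : HasDerivAt c c' t) (X : A) :
    HasDerivAt (fun s => exp (c s • X)) (c' • (X * exp (c t • X))) t :=
  (hasDerivAt_exp_smul_const' (𝕂 := ℂ) X (c t)).scomp t hc

omit [CompleteSpace A] in
theorem eq_of_hasDerivAt_zero {P : ℂ → A} (h : ∀ t, HasDerivAt P 0 t) (s t : ℂ) : P s = P t :=
  is_const_of_deriv_eq_zero (fun t => (h t).differentiableAt) (fun t => (h t).deriv) s t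

theorem exp_smul_mul_exp_neg_smul (X : A) (t : ℂ) : exp (t • X) * exp ((-t) • X) = 1 := by
  let _ : NormedAlgebra ℚ A := NormedAlgebra.restrictScalars ℚ ℂ A
  rw [← exp_add_of_commute, neg_smul, add_neg_cancel, exp_zero]
  exact ((Commute.refl X).smul_left t).smul_right (-t)

theorem exp_neg_smul_mul_exp_smul (X : A) (t : ℂ) : exp ((-t) • X) * exp (t • X) = 1 := by
  simpa using exp_smul_mul_exp_neg_smul X (-t)

theorem exp_add_smul' (X : A) (s t : ℂ) : exp ((s + t) • X) = exp (s • X) * exp (t • X) := by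
  let _ : NormedAlgebra ℚ A := NormedAlgebra.restrictScalars ℚ ℂ A
  rw [← exp_add_of_commute, add_smul]
  exact ((Commute.refl X).smul_left s).smul_right t

omit [CompleteSpace A] in
/-- Two curves with the same logarithmic derivative `W`, one of them with left inverse `R'`. -/
theorem eq_of_same_logDeriv {L R R' W : ℂ → A} (hL : ∀ t, HasDerivAt L (L t * W t) t)
    (hR' : ∀ t, HasDerivAt R' (-(W t * R' t)) t) (hRR : ∀ t, R' t * R t = 1)
    (h0 : L 0 * R' 0 = 1) (t : ℂ) : L t = R t := by
  have h : ∀ t, HasDerivAt (fun t => L t * R' t) 0 t := fun t => by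
    have := (hL t).fun_mul (hR' t)
    refine this.congr_deriv ?_
    noncomm_ring
  have h1 := eq_of_hasDerivAt_zero h t 0
  simp only [h0] at h1
  calc L t = L t * (R' t * R t) := by rw [hRR, mul_one]
    _ = R t := by rw [← mul_assoc, h1, one_mul]

/-- `Ad(exp tH)` scales an eigenvector of `ad H` by `e^(ct)`: the derivative of `e^(-ct) exp(tH) X
exp(-tH)` vanishes. -/
theorem exp_smul_mul_of_lie_eq_smul {H X : A} {c : ℂ} (h : H * X - X * H = c • X) (t : ℂ) :
    exp (t • H) * X = Complex.exp (c * t) • (X * exp (t • H)) := by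
  have hd : ∀ t, HasDerivAt
      (fun t : ℂ => Complex.exp (-(c * t)) • (exp (t • H) * X * exp ((-t) • H))) 0 t := fun t => by
    have h1 : HasDerivAt (fun t : ℂ => Complex.exp (-(c * t))) (Complex.exp (-(c * t)) * (-c)) t := by
      have := ((hasDerivAt_id' t).const_mul c).fun_neg.cexp
      simpa using this
    have h2 := hasDerivAt_exp_smul_comp (hasDerivAt_id' t) H
    have h3 := hasDerivAt_exp_smul_comp' (hasDerivAt_id' t).fun_neg H
    have := h1.fun_smul ((h2.mul_const X).fun_mul h3)
    refine this.congr_deriv ?_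
    have e : exp (t • H) * H * X * exp ((-t) • H) - exp (t • H) * X * (H * exp ((-t) • H))
        = c • (exp (t • H) * X * exp ((-t) • H)) := by
      have : exp (t • H) * (H * X - X * H) * exp ((-t) • H)
          = exp (t • H) * (c • X) * exp ((-t) • H) := by rw [h]
      simpa [mul_sub, sub_mul, mul_assoc] using this
    simp only [one_smul, neg_smul, mul_neg, ← sub_eq_add_neg] at e ⊢
    rw [e, smul_smul]
    simp
  have := eq_of_hasDerivAt_zero hd t 0
  simp only [neg_zero, zero_smul, exp_zero, mul_zero, Complex.exp_zero, one_mul, mul_one, one_smul] at this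
  calc exp (t • H) * X
      = Complex.exp (c * t) • ((Complex.exp (-(c * t)) • (exp (t • H) * X * exp ((-t) • H)))
          * exp (t • H)) := by
        rw [smul_mul_assoc, mul_assoc _ (exp ((-t) • H)), exp_neg_smul_mul_exp_smul, mul_one, smul_smul,
          ← Complex.exp_add, add_neg_cancel, Complex.exp_zero, one_smul]
    _ = _ := by rw [this]

/-- The commutation relations of the standard basis of `𝔰𝔩₂` in an associative algebra. -/
structure Sl2Relations (H X Y : A) : Prop where
  hx : H * X - X * H = (2 : ℂ) • X
  hy : H * Y - Y * H = (-2 : ℂ) • Y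
  xy : X * Y - Y * X = H

namespace Sl2Relations

variable {H X Y : A} (h : Sl2Relations H X Y)
include h

/-- This is `exp(t ad X) Y`, whose series stops at the quadratic term. Conjugating the right-hand
polynomial back by `exp(-tX)` gives a curve with zero derivative. -/
theorem exp_x_mul_y (t : ℂ) :
    exp (t • X) * Y = (Y + t • H - (t ^ 2) • X) * exp (t • X) := by
  have hd : ∀ t, HasDerivAt
      (fun t : ℂ => exp ((-t) • X) * (Y + t • H - (t ^ 2) • X) * exp (t • X)) 0 t := fun t => by
    have h1 := hasDerivAt_exp_smul_comp (hasDerivAt_id' t).fun_neg X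
    have h2 := hasDerivAt_exp_smul_comp' (hasDerivAt_id' t) X
    have h3 : HasDerivAt (fun t : ℂ => Y + t • H - (t ^ 2) • X) (H - (2 * t) • X) t := by
      have a := ((hasDerivAt_id' t).smul_const H).const_add Y
      have b := ((hasDerivAt_id' t).fun_pow 2).smul_const X
      simpa using a.fun_sub b
    have := (h1.fun_mul h3).fun_mul h2
    refine this.congr_deriv ?_
    simp only [one_smul, neg_smul]
    have e : -(X * (Y + t • H - (t ^ 2) • X)) + (H - (2 * t) • X) + (Y + t • H - (t ^ 2) • X) * X = 0 := by
      have e1 := h.xy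
      have e2 := h.hx
      have e1' : X * Y = H + Y * X := by rw [← e1]; abel
      have e2' : H * X = (2 : ℂ) • X + X * H := by rw [← e2]; abel
      simp only [mul_add, mul_sub, add_mul, sub_mul, mul_smul_comm, smul_mul_assoc, e1', e2', smul_add,
        smul_smul]
      rw [mul_comm t 2]
      abel
    have := congrArg (fun Z => exp (-(t • X)) * Z * exp (t • X)) e
    simp only [mul_zero, zero_mul] at this
    rw [← this]
    generalize Y + t • H - (t ^ 2) • X = Z
    simp only [neg_mul, mul_add, add_mul, mul_neg, mul_assoc]
  have := eq_of_hasDerivAt_zero hd t 0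
  simp only [neg_zero, zero_smul, exp_zero, one_mul, mul_one, ne_eq, OfNat.ofNat_ne_zero,
    not_false_eq_true, zero_pow, add_zero, sub_zero] at this
  calc exp (t • X) * Y = exp (t • X) * (exp ((-t) • X) * (Y + t • H - (t ^ 2) • X) * exp (t • X)) := by
        rw [this]
    _ = _ := by rw [← mul_assoc, ← mul_assoc, exp_smul_mul_exp_neg_smul, one_mul]

theorem exp_h_mul_x (t : ℂ) : exp (t • H) * X = Complex.exp (2 * t) • (X * exp (t • H)) :=
  exp_smul_mul_of_lie_eq_smul h.hx t

theorem exp_h_mul_y (t : ℂ) : exp (t • H) * Y = Complex.exp (-2 * t) • (Y * exp (t • H)) :=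
  exp_smul_mul_of_lie_eq_smul h.hy t

theorem exp_h_mul_exp_x (t c : ℂ) :
    exp (t • H) * exp (c • X) = exp ((Complex.exp (2 * t) * c) • X) * exp (t • H) := by
  let _ : NormedAlgebra ℚ A := NormedAlgebra.restrictScalars ℚ ℂ A
  let u : Aˣ := ⟨exp (t • H), exp ((-t) • H), exp_smul_mul_exp_neg_smul H t,
    exp_neg_smul_mul_exp_smul H t⟩
  have h1 := NormedSpace.exp_units_conj u (c • X)
  have h2 : (u : A) * (c • X) * ((u⁻¹ : Aˣ) : A) = (Complex.exp (2 * t) * c) • X := by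
    change exp (t • H) * (c • X) * exp ((-t) • H) = _
    rw [mul_smul_comm, h.exp_h_mul_x, smul_mul_assoc, smul_mul_assoc, mul_assoc,
      exp_smul_mul_exp_neg_smul, mul_one, smul_smul, mul_comm]
  rw [h2] at h1
  rw [h1, mul_assoc]
  change _ = exp (t • H) * exp (c • X) * (exp ((-t) • H) * exp (t • H))
  rw [exp_neg_smul_mul_exp_smul, mul_one]

/-- The Gauss decomposition of `exp (b X) exp (c Y)`, where `1 + b c = e ^ μ`. -/
theorem exp_x_mul_exp_y {b : ℂ} (hb : b ≠ 0) (μ : ℂ) :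
    exp (b • X) * exp (((Complex.exp μ - 1) / b) • Y) =
      exp (((1 - Complex.exp (-μ)) / b) • Y) * exp (μ • H) * exp ((b * Complex.exp (-μ)) • X) := by
  have hexp : ∀ t, HasDerivAt (fun t : ℂ => Complex.exp (-t)) (-Complex.exp (-t)) t := fun t => by
    simpa using (hasDerivAt_id' t).fun_neg.cexp
  have dc : ∀ t, HasDerivAt (fun t : ℂ => (Complex.exp t - 1) / b) (Complex.exp t / b) t := fun t =>
    ((Complex.hasDerivAt_exp t).sub_const 1).div_const b
  have dx : ∀ t, HasDerivAt (fun t : ℂ => -((1 - Complex.exp (-t)) / b)) (-(Complex.exp (-t) / b)) t :=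
    fun t => by
      have := (((hexp t).const_sub 1).div_const b).fun_neg
      simpa using this
  have dy : ∀ t, HasDerivAt (fun t : ℂ => -(b * Complex.exp (-t))) (b * Complex.exp (-t)) t :=
    fun t => by
      have := ((hexp t).const_mul b).fun_neg
      simpa using this
  -- The factor in `X` on the right is moved to the other side. With `μ` replaced by a variable `t`,
  -- both sides start at `1` and have logarithmic derivative `W`.
  let W : ℂ → A := fun t => (Complex.exp t / b) • Y + H
  have key := eq_of_same_logDeriv
    (L := fun t => exp (b • X) * exp (((Complex.exp t - 1) / b) • Y) *
      exp ((-(b * Complex.exp (-t))) • X))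
    (R := fun t => exp (((1 - Complex.exp (-t)) / b) • Y) * exp (t • H))
    (R' := fun t => exp ((-t) • H) * exp ((-((1 - Complex.exp (-t)) / b)) • Y)) (W := W)
    (fun t => by
      have h1 := hasDerivAt_exp_smul_comp (dc t) Y
      have h2 := hasDerivAt_exp_smul_comp (dy t) X
      have := (h1.const_mul (exp (b • X))).fun_mul h2
      refine this.congr_deriv ?_
      set a := b * Complex.exp (-t) with ha
      set U := exp ((-a) • X)
      have e1 : Y * U = U * (Y + a • H - (a ^ 2) • X) := by
        have := h.exp_x_mul_y a
        have h3 : U * (exp (a • X) * Y) * U = U * ((Y + a • H - (a ^ 2) • X) * exp (a • X)) * U := by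
          rw [this]
        have h4 : U * exp (a • X) = 1 := exp_neg_smul_mul_exp_smul X a
        have h5 : exp (a • X) * U = 1 := exp_smul_mul_exp_neg_smul X a
        rw [← mul_assoc, h4, one_mul, mul_assoc U, mul_assoc _ _ U, h5, mul_one] at h3
        exact h3
      have hab : Complex.exp t / b * a = 1 := by
        rw [ha, Complex.exp_neg]; field_simp
      have e2 : W t * 1 = (Complex.exp t / b) • (Y + a • H - (a ^ 2) • X) + a • X := by
        have : Complex.exp t / b * a ^ 2 = a := by rw [pow_two, ← mul_assoc, hab, one_mul]
        simp only [W, mul_one, smul_add, smul_sub, smul_smul, hab, this, one_smul]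
        abel
      rw [mul_one] at e2
      rw [e2]
      simp only [mul_add, mul_smul_comm, smul_mul_assoc, mul_assoc]
      rw [e1])
    (fun t => by
      have h1 := hasDerivAt_exp_smul_comp' (hasDerivAt_id' t).fun_neg H
      have h2 := hasDerivAt_exp_smul_comp' (dx t) Y
      have := h1.fun_mul h2
      refine this.congr_deriv ?_
      have e := h.exp_h_mul_y (-t)
      set V := exp ((-t) • H)
      rw [mul_smul_comm, ← mul_assoc V Y, e, smul_mul_assoc, smul_mul_assoc, smul_smul]
      have : -(Complex.exp (-t) / b) * Complex.exp (-2 * -t) = -(Complex.exp t / b) := by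
        rw [neg_mul, div_mul_eq_mul_div, ← Complex.exp_add]; congr 3; ring
      rw [this]
      simp only [W, add_mul, smul_mul_assoc, neg_smul, one_smul, mul_assoc]
      abel)
    (fun t => by
      rw [mul_assoc, ← mul_assoc (exp (_ • Y)) (exp (_ • Y)), exp_neg_smul_mul_exp_smul, one_mul,
        exp_neg_smul_mul_exp_smul])
    (by simpa using exp_smul_mul_exp_neg_smul X b) μ
  rw [← key, mul_assoc _ _ (exp ((b * Complex.exp (-μ)) • X)), exp_neg_smul_mul_exp_smul, mul_one]

/-- `exp (b X) exp (c Y)` is conjugate to `exp (μ H)` if `2 + b c = e ^ μ + e ^ (-μ)`. -/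
theorem exp_x_mul_exp_y_eq_conj {b μ : ℂ} (hb : b ≠ 0) (hμ : Complex.exp μ ^ 2 ≠ 1) :
    exp (b • X) * exp (((Complex.exp μ + Complex.exp (-μ) - 2) / b) • Y) =
      (exp (((1 - Complex.exp (-μ)) / b) • Y) *
        exp ((Complex.exp μ * b / (1 - Complex.exp μ ^ 2)) • X)) * exp (μ • H) *
      (exp ((-(Complex.exp μ * b / (1 - Complex.exp μ ^ 2))) • X) *
        exp ((-((1 - Complex.exp (-μ)) / b)) • Y)) := by
  have h0 : (1 - Complex.exp μ ^ 2) ≠ 0 := fun hh => hμ (by linear_combination -hh)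
  set x := (1 - Complex.exp (-μ)) / b with hx
  -- Moving both powers of `exp X` to the left of `exp(μH)` turns `e2` into `e^μ b = y - e^(2μ) y`,
  -- which determines `y`.
  set y := Complex.exp μ * b / (1 - Complex.exp μ ^ 2) with hy
  -- The Gauss decomposition covers `(e^μ - 1)/b`; the remaining `-x` supplies the inverse of the
  -- left factor `exp(xY)`.
  have e1 : (Complex.exp μ + Complex.exp (-μ) - 2) / b = (Complex.exp μ - 1) / b + (-x) := by
    rw [hx]; ring
  rw [e1, exp_add_smul', ← mul_assoc, h.exp_x_mul_exp_y hb, ← hx]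
  have e2 : exp (μ • H) * exp ((b * Complex.exp (-μ)) • X)
      = exp (y • X) * exp (μ • H) * exp ((-y) • X) := by
    rw [h.exp_h_mul_exp_x, mul_assoc, h.exp_h_mul_exp_x, ← mul_assoc (exp (y • X)), ← exp_add_smul']
    congr 3
    have : Complex.exp (2 * μ) = Complex.exp μ ^ 2 := by rw [← Complex.exp_nat_mul]; norm_num
    rw [this, hy, Complex.exp_neg]
    have := Complex.exp_ne_zero μ
    field_simp
    ring
  rw [mul_assoc (exp (x • Y)), e2]
  simp only [mul_assoc]

end Sl2Relations

end BanachAlgebra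

/-! ### Logarithms of endomorphisms and the monodromy obstruction -/

section LinearAlgebra

open NormedSpace

variable {E : Type*} [NormedAddCommGroup E] [NormedSpace ℂ E] [FiniteDimensional ℂ E]

/-- The trace of continuous endomorphisms of a finite-dimensional space. -/
noncomputable def ContinuousLinearMap.endTrace : (E →L[ℂ] E) →ₗ[ℂ] ℂ :=
  LinearMap.trace ℂ E ∘ₗ ContinuousLinearMap.coeLM ℂ

open ContinuousLinearMap (endTrace)

theorem continuous_endTrace : Continuous (endTrace : (E →L[ℂ] E) →ₗ[ℂ] ℂ) :=
  LinearMap.continuous_of_finiteDimensional _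

variable [CompleteSpace E]

omit [FiniteDimensional ℂ E] in
theorem exp_apply_of_apply_eq_smul {C : E →L[ℂ] E} {c : ℂ} {v : E} (h : C v = c • v) :
    exp C v = Complex.exp c • v := by
  have hd : ∀ t, HasDerivAt (fun t : ℂ => Complex.exp (-(c * t)) • exp (t • C) v) 0 t := fun t => by
    have h1 : HasDerivAt (fun t : ℂ => Complex.exp (-(c * t))) (Complex.exp (-(c * t)) * (-c)) t := by
      simpa using ((hasDerivAt_id' t).const_mul c).fun_neg.cexp
    have h2 := (hasDerivAt_exp_smul_const (𝕂 := ℂ) C t).clm_apply (hasDerivAt_const t v)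
    refine (h1.fun_smul h2).congr_deriv ?_
    simp [h, smul_smul]
  have := is_const_of_deriv_eq_zero (fun t => (hd t).differentiableAt) (fun t => (hd t).deriv) 1 0
  simp only [mul_one, one_smul, mul_zero, neg_zero, Complex.exp_zero, zero_smul, exp_zero,
    one_apply_eq_self] at this
  calc exp C v = Complex.exp c • Complex.exp (-c) • exp C v := by
        rw [smul_smul, ← Complex.exp_add, add_neg_cancel, Complex.exp_zero, one_smul]
    _ = _ := by rw [this]

omit [FiniteDimensional ℂ E] in
theorem clm_exp_smul_mul_exp_neg_smul (X : E →L[ℂ] E) (t : ℂ) : exp (t • X) * exp ((-t) • X) = 1 :=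
  exp_smul_mul_exp_neg_smul X t

omit [FiniteDimensional ℂ E] in
theorem clm_exp_neg_smul_mul_exp_smul (X : E →L[ℂ] E) (t : ℂ) : exp ((-t) • X) * exp (t • X) = 1 :=
  exp_neg_smul_mul_exp_smul X t

/-- Every eigenvalue `c` of `C` satisfies `e^c = 1`, and the trace is the sum of the roots of the
characteristic polynomial. -/
theorem endTrace_of_exp_eq_one {C : E →L[ℂ] E} (h : exp C = 1) :
    ∃ k : ℤ, endTrace C = k * (2 * Real.pi * Complex.I) := by
  have h1 : endTrace C = (LinearMap.charpoly (C : E →ₗ[ℂ] E)).roots.sum :=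
    Module.End.trace_eq_sum_roots_charpoly_of_splits (IsAlgClosed.splits _)
  rw [h1]
  refine Multiset.sum_induction (fun c : ℂ => ∃ k : ℤ, c = k * (2 * Real.pi * Complex.I)) _ ?_
    ⟨0, by simp⟩ ?_
  · rintro a b ⟨k, rfl⟩ ⟨l, rfl⟩
    exact ⟨k + l, by push_cast; ring⟩
  · intro c hc
    have hev : Module.End.HasEigenvalue (C : E →ₗ[ℂ] E) c :=
      (Module.End.hasEigenvalue_iff_isRoot_charpoly _ _).2 (Polynomial.isRoot_of_mem_roots hc)
    obtain ⟨v, hv⟩ := hev.exists_hasEigenvector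
    have h2 := exp_apply_of_apply_eq_smul (C := C) (c := c) (v := v) hv.apply_eq_smul
    rw [h, one_apply_eq_self] at h2
    have h3 : (Complex.exp c - 1) • v = 0 := by rw [sub_smul, one_smul, ← h2, sub_self]
    have h4 : Complex.exp c = 1 := sub_eq_zero.1 ((smul_eq_zero.1 h3).resolve_right hv.2)
    exact Complex.exp_eq_one_iff.1 h4

theorem exp_int_smul_eq_one {A : Type*} [NormedRing A] [NormedAlgebra ℂ A] [CompleteSpace A]
    {B : A} (h : exp B = 1) (j : ℤ) : exp ((j : ℂ) • B) = 1 := by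
  let _ : NormedAlgebra ℚ A := NormedAlgebra.restrictScalars ℚ ℂ A
  have hn : ∀ n : ℕ, exp ((n : ℂ) • B) = 1 := fun n => by
    rw [Nat.cast_smul_eq_nsmul, exp_nsmul, h, one_pow]
  obtain ⟨n, rfl | rfl⟩ := j.eq_nat_or_neg
  · exact_mod_cast hn n
  · have := exp_neg_smul_mul_exp_smul B (n : ℂ)
    rw [hn, mul_one] at this
    exact_mod_cast this

/-- `H` is diagonalizable with integer eigenvalues. -/
def IsIntegerDiagonalizable (H : E →L[ℂ] E) : Prop :=
  Submodule.span ℂ {v | ∃ j : ℤ, H v = (j : ℂ) • v} = ⊤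

omit [FiniteDimensional ℂ E] [CompleteSpace E] in
theorem IsIntegerDiagonalizable.ext {H : E →L[ℂ] E} (hH : IsIntegerDiagonalizable H)
    {A B : E →L[ℂ] E} (h : ∀ (j : ℤ) (v : E), H v = (j : ℂ) • v → A v = B v) : A = B := by
  have : (A : E →ₗ[ℂ] E) = B := LinearMap.ext_on hH (by rintro v ⟨j, hj⟩; exact h j v hj)
  exact ContinuousLinearMap.coe_injective this

/-- The numbers `e^(jμ)` have distinct moduli because `Re μ ≠ 0`, so interpolating `e^(jμ) ↦ j`
exhibits `H` as a polynomial in `exp(μH)`. -/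
theorem IsIntegerDiagonalizable.commute_of_commute_exp {H : E →L[ℂ] E}
    (hH : IsIntegerDiagonalizable H) {μ : ℂ} (hμ : μ.re ≠ 0) {A : E →L[ℂ] E}
    (hA : Commute A (exp (μ • H))) : Commute A H := by
  classical
  have hinj : Function.Injective (fun j : ℤ => Complex.exp (j * μ)) := fun i j hij => by
    have := congrArg norm hij
    simp only [Complex.norm_exp, Complex.mul_re, Complex.intCast_re, Complex.intCast_im, zero_mul,
      sub_zero, Real.exp_eq_exp] at this
    exact_mod_cast mul_right_cancel₀ hμ this
  have hfin : {j : ℤ | Module.End.HasEigenvalue (H : E →ₗ[ℂ] E) (j : ℂ)}.Finite :=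
    Set.Finite.preimage Int.cast_injective.injOn (Module.End.finite_hasEigenvalue _)
  let p : Polynomial ℂ := Lagrange.interpolate hfin.toFinset (fun j : ℤ => Complex.exp (j * μ))
    (fun j : ℤ => (j : ℂ))
  have hp : Polynomial.aeval (exp (μ • H)) p = H := by
    refine hH.ext fun j v hv => ?_
    by_cases hv0 : v = 0
    · simp [hv0]
    have hj : j ∈ hfin.toFinset := by
      simp only [Set.Finite.mem_toFinset, Set.mem_ofPred_eq]
      exact Module.End.hasEigenvalue_of_hasEigenvector
        (Module.End.hasEigenvector_iff.2 ⟨Module.End.mem_eigenspace_iff.2 hv, hv0⟩)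
    have he : exp (μ • H) v = Complex.exp (j * μ) • v :=
      exp_apply_of_apply_eq_smul (by simp [hv, smul_smul, mul_comm])
    have hev : ∀ q : Polynomial ℂ, Polynomial.aeval (exp (μ • H)) q v
        = q.eval (Complex.exp (j * μ)) • v := fun q => by
      induction q using Polynomial.induction_on' with
      | add q r hq hr => simp [hq, hr, add_smul]
      | monomial n a =>
        have hpow : ∀ n : ℕ, ((exp (μ • H)) ^ n) v = (Complex.exp (j * μ) ^ n) • v := fun n => by
          induction n with
          | zero => simp
          | succ n ih => rw [pow_succ, mul_apply_eq_comp, he, map_smul, ih, smul_smul,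
              pow_succ, mul_comm]
        rw [Polynomial.aeval_monomial, Polynomial.eval_monomial, ← Algebra.smul_def,
          smul_apply, hpow, smul_smul]
    rw [hev, Lagrange.eval_interpolate_at_node _ hinj.injOn hj, hv]
  have hmem : ∀ q : Polynomial ℂ, Commute A (Polynomial.aeval (exp (μ • H)) q) := fun q => by
    induction q using Polynomial.induction_on' with
    | add q r hq hr => rw [map_add]; exact hq.add_right hr
    | monomial n a =>
      rw [Polynomial.aeval_monomial]
      exact (Algebra.commute_algebraMap_right a A).mul_right (hA.pow_right n)
  exact hp ▸ hmem p

/-- If `exp A = exp (μ H)` then `tr (A H) = μ tr (H ^ 2)` up to `2 π i ℤ`. -/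
theorem IsIntegerDiagonalizable.endTrace_mul {H : E →L[ℂ] E}
    (hH : IsIntegerDiagonalizable H) {μ : ℂ} (hμ : μ.re ≠ 0) {A : E →L[ℂ] E}
    (hA : exp A = exp (μ • H)) :
    ∃ k : ℤ, endTrace (A * H) - μ * endTrace (H * H) = k * (2 * Real.pi * Complex.I) := by
  let _ : NormedAlgebra ℚ (E →L[ℂ] E) := NormedAlgebra.restrictScalars ℚ ℂ _
  have hc : Commute A H := hH.commute_of_commute_exp hμ (hA ▸ (Commute.refl A).exp_right)
  set B := A - μ • H with hB
  have hBH : Commute B H := hc.sub_left ((Commute.refl H).smul_left μ)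
  have hexpB : exp B = 1 := by
    have e1 : B = A + (-μ) • H := by rw [hB, neg_smul, sub_eq_add_neg]
    rw [e1, exp_add_of_commute (hc.smul_right _), hA, clm_exp_smul_mul_exp_neg_smul]
  -- On the `j`-eigenspace of `H`, `BH` acts as `jB`, and `exp(jB) = 1` because `j` is an integer.
  -- The difference `BH - jB` kills that eigenspace, so its exponential fixes it.
  have hexp : exp (B * H) = 1 := by
    refine hH.ext fun j v hv => ?_
    have h1 : (B * H - (j : ℂ) • B) v = (0 : ℂ) • v := by
      simp [hv]
    have h2 := exp_apply_of_apply_eq_smul h1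
    have h3 : exp (B * H) = exp (B * H - (j : ℂ) • B) * exp ((j : ℂ) • B) := by
      rw [← exp_add_of_commute, sub_add_cancel]
      exact (((Commute.refl B).mul_left hBH.symm).sub_left ((Commute.refl B).smul_left _)).smul_right _
    rw [h3, exp_int_smul_eq_one hexpB, mul_one, h2]
    simp
  obtain ⟨k, hk⟩ := endTrace_of_exp_eq_one hexp
  refine ⟨k, ?_⟩
  rw [← hk, hB, sub_mul, map_sub, smul_mul_assoc, map_smul, smul_eq_mul]

theorem eq_of_continuous_of_forall_int {q : ℝ → ℂ} (hq : Continuous q)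
    (h : ∀ t, ∃ k : ℤ, q t = k) (s t : ℝ) : q s = q t := by
  choose k hk using h
  have hk' : Continuous k := by
    rw [Int.isClosedEmbedding_coe_real.isEmbedding.continuous_iff]
    have : (Int.cast ∘ k : ℝ → ℝ) = fun t => (q t).re := by
      ext t; simp [hk]
    rw [this]
    exact Complex.continuous_re.comp hq
  rw [hk, hk, PreconnectedSpace.constant inferInstance hk' (x := s) (y := t)]

/-- The loop `z ↦ exp (s X) exp (s (z - 1) Y)` has no continuous logarithm on `ℂ^*`. -/
theorem Sl2Relations.not_exists_log {H X Y : E →L[ℂ] E} (h : Sl2Relations H X Y)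
    (hH : IsIntegerDiagonalizable H) (htr : endTrace (H * H) ≠ 0) {s : ℝ} (hs0 : 0 < s)
    (hs1 : s ≤ 1) {A : ℂ → E →L[ℂ] E} (hA : ContinuousOn A {0}ᶜ)
    (hlog : ∀ z ≠ 0, exp (A z) = exp ((s : ℂ) • X) * exp (((s : ℂ) * (z - 1)) • Y)) : False := by
  let _ : NormedAlgebra ℚ (E →L[ℂ] E) := NormedAlgebra.restrictScalars ℚ ℂ _
  have hs : (s : ℂ) ≠ 0 := by exact_mod_cast hs0.ne'
  -- The real part `2` makes `e^μ` larger in modulus than `3`. This keeps `e^(2μ)` away from `1` and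
  -- the curve `z` below away from `0`.
  let μ : ℝ → ℂ := fun θ => 1 + 1 + θ * Complex.I
  have hμc : Continuous μ := by fun_prop
  have hμre : ∀ θ, (μ θ).re = 2 := fun θ => by simp [μ]; norm_num
  have hnorm : ∀ θ, ‖Complex.exp (μ θ)‖ = Real.exp 2 := fun θ => by rw [Complex.norm_exp, hμre]
  have hnorm' : ∀ θ, ‖Complex.exp (-μ θ)‖ ≤ 1 := fun θ => by
    rw [Complex.norm_exp, Complex.neg_re, hμre, Real.exp_le_one_iff]; norm_num
  have he3 : (3 : ℝ) < Real.exp 2 := by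
    have := Real.add_one_lt_exp (x := 2) (by norm_num); linarith
  have hsq : ∀ θ, Complex.exp (μ θ) ^ 2 ≠ 1 := fun θ hh => by
    have := congrArg norm hh
    rw [norm_pow, hnorm, norm_one] at this
    nlinarith
  -- Solves `2 + s² (z - 1) = e^μ + e^(-μ)`. A zero of `z` would give `e^μ = 2 - s² - e^(-μ)`, of
  -- modulus at most `3`.
  let z : ℝ → ℂ := fun θ => 1 + (Complex.exp (μ θ) + Complex.exp (-μ θ) - 2) / s ^ 2
  have hz : ∀ θ, z θ ≠ 0 := fun θ hh => by
    have h1 : Complex.exp (μ θ) = (2 - (s : ℂ) ^ 2) - Complex.exp (-μ θ) := by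
      simp only [z] at hh
      field_simp at hh
      linear_combination hh
    have h2 := congrArg norm h1
    have h3 : ‖(2 - (s : ℂ) ^ 2)‖ ≤ 2 := by
      have : (2 - (s : ℂ) ^ 2) = ((2 - s ^ 2 : ℝ) : ℂ) := by push_cast; ring
      rw [this, Complex.norm_real, Real.norm_eq_abs, abs_le]
      constructor <;> nlinarith
    have h4 := norm_sub_le (2 - (s : ℂ) ^ 2) (Complex.exp (-μ θ))
    rw [hnorm] at h2
    linarith [hnorm' θ]
  have hzc : Continuous z := by fun_prop
  let x : ℝ → ℂ := fun θ => (1 - Complex.exp (-μ θ)) / s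
  let y : ℝ → ℂ := fun θ => Complex.exp (μ θ) * s / (1 - Complex.exp (μ θ) ^ 2)
  have hxc : Continuous x := by fun_prop
  have hyc : Continuous y := by
    refine Continuous.div (by fun_prop) (by fun_prop) fun θ => ?_
    exact sub_ne_zero.2 (hsq θ).symm
  let g : ℝ → E →L[ℂ] E := fun θ => exp (x θ • Y) * exp (y θ • X)
  let g' : ℝ → E →L[ℂ] E := fun θ => exp ((-y θ) • X) * exp ((-x θ) • Y)
  have hexpc : Continuous (exp : (E →L[ℂ] E) → (E →L[ℂ] E)) := exp_continuous
  have hgc : Continuous g := by fun_prop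
  have hgc' : Continuous g' := by fun_prop
  have hgg' : ∀ θ, g θ * g' θ = 1 := fun θ => by
    simp only [g, g']
    rw [mul_assoc, ← mul_assoc (exp (y θ • X)), clm_exp_smul_mul_exp_neg_smul, one_mul,
      clm_exp_smul_mul_exp_neg_smul]
  have hg'g : ∀ θ, g' θ * g θ = 1 := fun θ => by
    simp only [g, g']
    rw [mul_assoc, ← mul_assoc (exp ((-x θ) • Y)), clm_exp_neg_smul_mul_exp_smul, one_mul,
      clm_exp_neg_smul_mul_exp_smul]
  have hconj : ∀ θ, exp (A (z θ)) = g θ * exp (μ θ • H) * g' θ := fun θ => by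
    rw [hlog _ (hz θ)]
    have := h.exp_x_mul_exp_y_eq_conj hs (hsq θ)
    rw [← this]
    congr 3
    simp only [z]
    field_simp
    ring
  have hint : ∀ θ, ∃ k : ℤ, (endTrace (g' θ * A (z θ) * g θ * H) - μ θ * endTrace (H * H)) /
      (2 * Real.pi * Complex.I) = k := fun θ => by
    let u : (E →L[ℂ] E)ˣ := ⟨g' θ, g θ, hg'g θ, hgg' θ⟩
    have h1 : exp (g' θ * A (z θ) * g θ) = exp (μ θ • H) := by
      have := exp_units_conj u (A (z θ))
      rw [show exp (g' θ * A (z θ) * g θ) = g' θ * exp (A (z θ)) * g θ from this, hconj]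
      simp only [mul_assoc, hg'g, mul_one]
      rw [← mul_assoc, hg'g, one_mul]
    obtain ⟨k, hk⟩ := hH.endTrace_mul (by rw [hμre]; norm_num) h1
    refine ⟨k, ?_⟩
    rw [hk, mul_div_assoc, div_self Complex.two_pi_I_ne_zero, mul_one]
  have hAc : Continuous fun θ => A (z θ) :=
    hA.comp_continuous hzc fun θ => hz θ
  have hc : Continuous fun θ => (endTrace (g' θ * A (z θ) * g θ * H) - μ θ * endTrace (H * H)) /
      (2 * Real.pi * Complex.I) := by
    refine Continuous.div_const (Continuous.sub (continuous_endTrace.comp ?_) (by fun_prop)) _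
    exact ((hgc'.mul hAc).mul hgc).mul continuous_const
  -- After one turn everything except `μ` has returned, so equality of the two integers leaves `2πi
  -- tr(H²) = 0`.
  have hconst := eq_of_continuous_of_forall_int hc hint (2 * Real.pi) 0
  have hper : Complex.exp (μ (2 * Real.pi)) = Complex.exp (μ 0) := by
    have : μ (2 * Real.pi) = μ 0 + 2 * Real.pi * Complex.I := by simp [μ]
    rw [this, Complex.exp_periodic]
  have hper' : Complex.exp (-μ (2 * Real.pi)) = Complex.exp (-μ 0) := by
    rw [Complex.exp_neg, Complex.exp_neg, hper]
  have hx2 : x (2 * Real.pi) = x 0 := by simp only [x, hper']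
  have hy2 : y (2 * Real.pi) = y 0 := by simp only [y, hper]
  have hz2 : z (2 * Real.pi) = z 0 := by simp only [z, hper, hper']
  have hg2 : g (2 * Real.pi) = g 0 := by simp only [g, hx2, hy2]
  have hg2' : g' (2 * Real.pi) = g' 0 := by simp only [g', hx2, hy2]
  simp only [hg2, hg2', hz2] at hconst
  rw [div_left_inj' Complex.two_pi_I_ne_zero, sub_right_inj] at hconst
  have h5 := mul_right_cancel₀ htr hconst
  have : (2 * Real.pi * Complex.I : ℂ) = 0 := by
    simp only [μ] at h5
    push_cast at h5
    linear_combination h5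
  exact Complex.two_pi_I_ne_zero this

end LinearAlgebra

/-! ### Coroots in a complex semisimple Lie algebra -/

section LieAlgebra

variable (L : Type*) [LieRing L] [LieAlgebra ℂ L] [Module.Finite ℂ L] [Nontrivial L]

/-- Take `h` to be the coroot of a root `α`. It acts on each root space by an integer read off from
a root string, and these spaces span. The trace is the Killing form of `h` with itself, twice `α(h)
= 2` divided by a nonzero number. A root exists because the roots span the dual of a Cartan
subalgebra: without roots that subalgebra would be `0`, hence not self-normalizing. -/
theorem LieAlgebra.exists_isSl2Triple_of_isSemisimple [LieAlgebra.IsSemisimple ℂ L] :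
    ∃ h e f : L, IsSl2Triple h e f ∧
      Submodule.span ℂ {v : L | ∃ j : ℤ, ⁅h, v⁆ = (j : ℂ) • v} = ⊤ ∧
      LinearMap.trace ℂ L (LieAlgebra.ad ℂ L h * LieAlgebra.ad ℂ L h) ≠ 0 := by
  obtain ⟨x, hx⟩ := LieAlgebra.exists_isCartanSubalgebra_engel ℂ L
  set H := LieSubalgebra.engel ℂ x
  have hα : ∃ α : LieModule.Weight ℂ H L, α.IsNonZero := by
    by_contra! hcon
    have h1 := LieAlgebra.IsKilling.span_weight_isNonZero_eq_top ℂ L H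
    have h2 : {α : LieModule.Weight ℂ H L | α.IsNonZero} = ∅ :=
      Set.eq_empty_iff_forall_notMem.2 fun α h => h (hcon α)
    rw [h2, Set.image_empty, Submodule.span_empty] at h1
    have h3 : ∀ y : H, y = 0 := fun y => by
      rw [← Module.forall_dual_apply_eq_zero_iff ℂ y]
      intro φ
      have : φ ∈ (⊥ : Submodule ℂ (Module.Dual ℂ H)) := h1 ▸ Submodule.mem_top
      rw [(Submodule.mem_bot ℂ).1 this, LinearMap.zero_apply]
    obtain ⟨w, hw⟩ := exists_ne (0 : L)
    have h4 : w ∈ H.normalizer := by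
      rw [LieSubalgebra.mem_normalizer_iff]
      intro y hy
      have : y = 0 := congrArg Subtype.val (h3 ⟨y, hy⟩)
      simp [this]
    rw [hx.self_normalizing] at h4
    exact hw (congrArg Subtype.val (h3 ⟨w, h4⟩))
  obtain ⟨α, hα⟩ := hα
  obtain ⟨h, e, f, ht, he, hf⟩ := LieAlgebra.IsKilling.exists_isSl2Triple_of_weight_isNonZero hα
  have hh := ht.h_eq_coroot hα he hf
  refine ⟨h, e, f, ht, ?_, ?_⟩
  · rw [eq_top_iff]
    have h1 := LieModule.iSup_genWeightSpace_eq_top' ℂ H L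
    rw [← LieSubmodule.toSubmodule_inj, LieSubmodule.iSup_toSubmodule, LieSubmodule.top_toSubmodule]
      at h1
    rw [← h1]
    refine iSup_le fun β v hv => Submodule.subset_span ?_
    refine ⟨LieModule.chainBotCoeff α β - LieModule.chainTopCoeff α β, ?_⟩
    rw [← LieAlgebra.IsKilling.apply_coroot_eq_cast, hh]
    exact LieAlgebra.IsKilling.lie_eq_smul_of_mem_rootSpace hv _
  · have h1 := LieAlgebra.IsKilling.traceForm_coroot α (LieAlgebra.IsKilling.coroot α)
    rw [LieModule.traceForm_apply_apply] at h1
    have h2 : LinearMap.trace ℂ L (LieAlgebra.ad ℂ L h * LieAlgebra.ad ℂ L h) =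
      2 • (α ((LieAlgebra.IsKilling.cartanEquivDual H).symm α))⁻¹ •
        α (LieAlgebra.IsKilling.coroot α) := by
      rw [← h1, hh]; rfl
    rw [h2, LieAlgebra.IsKilling.root_apply_coroot hα]
    have := LieAlgebra.IsKilling.root_apply_cartanEquivDual_symm_ne_zero hα
    simpa using this

end LieAlgebra

/-! ### The subalgebra spanned by an `𝔰𝔩₂`-triple -/

section Sl2Equiv

variable {L : Type*} [LieRing L] [LieAlgebra ℂ L]

open LieAlgebra.SpecialLinear Matrix

/-- The three vectors belong to the distinct eigenvalues `0, 2, -2` of `ad h`; bracketing twice with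
`h` separates them. -/
theorem IsSl2Triple.eq_zero_of_combination_eq_zero {h e f : L} (t : IsSl2Triple h e f) {a b c : ℂ}
    (H : a • h + b • e + c • f = 0) : a = 0 ∧ b = 0 ∧ c = 0 := by
  have he := t.lie_h_e_smul ℂ
  have hf := t.lie_lie_smul_f ℂ
  have h1 : b • e - c • f = 0 := by
    have := congrArg (fun x => ⁅h, x⁆) H
    simp only [lie_add, lie_smul, lie_self, smul_zero, zero_add, he, hf, lie_zero, smul_neg] at this
    have h2 : (2 : ℂ) • (b • e - c • f) = 0 := by
      rw [← this]; module
    exact (smul_eq_zero.1 h2).resolve_left two_ne_zero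
  have h2 : b • e + c • f = 0 := by
    have := congrArg (fun x => ⁅h, x⁆) h1
    simp only [lie_sub, lie_smul, lie_zero, he, hf, smul_neg] at this
    have h2 : (2 : ℂ) • (b • e + c • f) = 0 := by
      rw [← this]; module
    exact (smul_eq_zero.1 h2).resolve_left two_ne_zero
  have hb : b • e = 0 := by
    have : (2 : ℂ) • (b • e) = (b • e - c • f) + (b • e + c • f) := by module
    rw [h1, h2, add_zero] at this
    exact (smul_eq_zero.1 this).resolve_left two_ne_zero
  have hc : c • f = 0 := by rwa [hb, zero_add] at h2
  have ha : a • h = 0 := by rwa [hb, hc, add_zero, add_zero] at H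
  exact ⟨(smul_eq_zero.1 ha).resolve_right t.h_ne_zero,
    (smul_eq_zero.1 hb).resolve_right t.e_ne_zero, (smul_eq_zero.1 hc).resolve_right t.f_ne_zero⟩

/-- The Lie algebra map `𝔰𝔩₂ → L` belonging to an `𝔰𝔩₂`-triple. -/
def IsSl2Triple.lieHom {h e f : L} (t : IsSl2Triple h e f) : sl (Fin 2) ℂ →ₗ⁅ℂ⁆ L where
  toFun A := A.val 0 0 • h + A.val 0 1 • e + A.val 1 0 • f
  map_add' A B := by
    change (A.val + B.val) 0 0 • h + (A.val + B.val) 0 1 • e + (A.val + B.val) 1 0 • f = _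
    simp only [Matrix.add_apply]; module
  map_smul' c A := by
    change (c • A.val) 0 0 • h + (c • A.val) 0 1 • e + (c • A.val) 1 0 • f = _
    simp only [Matrix.smul_apply, smul_eq_mul, RingHom.id_apply]; module
  map_lie' {A B} := by
    have htr : ∀ A : sl (Fin 2) ℂ, A.val 1 1 = -A.val 0 0 := fun A => by
      have : Matrix.trace A.val = 0 := A.2
      rw [Matrix.trace_fin_two] at this
      linear_combination this
    have he := t.lie_h_e_smul ℂ
    have hf := t.lie_lie_smul_f ℂ
    have hef := t.lie_e_f
    have he' : ⁅e, h⁆ = -((2 : ℂ) • e) := by rw [← lie_skew, he]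
    have hf' : ⁅f, h⁆ = (2 : ℂ) • f := by rw [← lie_skew, hf, neg_neg]
    have hef' : ⁅f, e⁆ = -h := by rw [← lie_skew, hef]
    simp only [sl_bracket, Matrix.sub_apply, Matrix.mul_apply, Fin.sum_univ_two, htr A, htr B,
      add_lie, lie_add, smul_lie, lie_smul, lie_self, he, hf, hef, he', hf', hef']
    module

theorem IsSl2Triple.nonempty_equiv_sl {h e f : L} (t : IsSl2Triple h e f) :
    Nonempty (t.toLieSubalgebra ℂ ≃ₗ⁅ℂ⁆ sl (Fin 2) ℂ) := by
  have hinj : Function.Injective t.lieHom := by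
    rw [injective_iff_map_eq_zero]
    intro A hA
    obtain ⟨h1, h2, h3⟩ := t.eq_zero_of_combination_eq_zero hA
    have h4 : A.val 1 1 = 0 := by
      have : Matrix.trace A.val = 0 := A.2
      rw [Matrix.trace_fin_two, h1, zero_add] at this
      exact this
    apply Subtype.ext
    ext i j
    fin_cases i <;> fin_cases j
    exacts [h1, h2, h3, h4]
  have hrange : t.lieHom.range = t.toLieSubalgebra ℂ := by
    ext x
    rw [LieHom.mem_range, t.mem_toLieSubalgebra_iff, t.lie_e_f]
    constructor
    · rintro ⟨A, rfl⟩
      exact ⟨A.val 0 1, A.val 1 0, A.val 0 0, by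
        change A.val 0 0 • h + A.val 0 1 • e + A.val 1 0 • f = _
        abel⟩
    · rintro ⟨b, c, a, rfl⟩
      refine ⟨⟨!![a, b; c, -a], ?_⟩, ?_⟩
      · change Matrix.trace !![a, b; c, -a] = 0
        simp [Matrix.trace_fin_two]
      · change a • h + b • e + c • f = _
        abel
  exact ⟨((LieEquiv.ofInjective t.lieHom hinj).trans (LieEquiv.ofEq _ _ (by rw [hrange]))).symm⟩

end Sl2Equiv

/-! ### Holomorphic differential equations in complex time -/

section ComplexODE

open Metric Filter

variable {E : Type*} [NormedAddCommGroup E] [NormedSpace ℂ E] [CompleteSpace E]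

/-- Picard's theorem for autonomous holomorphic differential equations in complex time. -/
theorem exists_hasDerivAt_complex_of_contDiffAt {V : E → E} {x₀ : E} (hV : ContDiffAt ℂ 1 V x₀) :
    ∃ r > 0, ∃ c : ℂ → E, c 0 = x₀ ∧ ∀ t ∈ ball (0 : ℂ) r, HasDerivAt c (V (c t)) t := by
  obtain ⟨K, s, hs, hK⟩ := hV.exists_lipschitzOnWith
  have hd : ∀ᶠ x in 𝓝 x₀, DifferentiableAt ℂ V x :=
    (hV.eventually (by simp)).mono fun x hx => hx.differentiableAt one_ne_zero
  obtain ⟨R, hR, hball⟩ := nhds_basis_closedBall.mem_iff.1 (inter_mem hs hd)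
  have hlip : ∀ x ∈ closedBall x₀ R, ∀ y ∈ closedBall x₀ R, ‖V x - V y‖ ≤ K * ‖x - y‖ :=
    fun x hx y hy => by
      simpa [dist_eq_norm] using hK.dist_le_mul x (hball hx).1 y (hball hy).1
  set M : ℝ := ‖V x₀‖ + K * R + 1 with hM
  have hM0 : 0 < M := by positivity
  have hVM : ∀ x ∈ closedBall x₀ R, ‖V x‖ ≤ M := fun x hx => by
    have h1 := hlip x hx x₀ (mem_closedBall_self hR.le)
    have h2 : ‖x - x₀‖ ≤ R := by rwa [mem_closedBall, dist_eq_norm] at hx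
    have h3 := norm_le_norm_add_norm_sub' (V x) (V x₀)
    have h4 : (K : ℝ) * ‖x - x₀‖ ≤ K * R := by gcongr
    linarith
  -- The first bound keeps the Picard iterates in the ball of radius `R`; the second makes each step
  -- contract by `1/2`.
  set r : ℝ := min (R / M) (1 / (2 * (K + 1))) with hr
  have hr0 : 0 < r := by positivity
  have hrM : M * r ≤ R := by
    calc M * r ≤ M * (R / M) := by gcongr; exact min_le_left _ _
      _ = R := by field_simp
  have hrK : (K : ℝ) * r ≤ 1 / 2 := by
    calc (K : ℝ) * r ≤ (K + 1) * (1 / (2 * (K + 1))) := by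
          gcongr
          · linarith
          · exact min_le_right _ _
      _ = 1 / 2 := by field_simp
  have h0 : (0 : ℂ) ∈ ball (0 : ℂ) r := mem_ball_self hr0
  have hnorm : ∀ t ∈ ball (0 : ℂ) r, ‖t - 0‖ ≤ r := fun t ht => by
    rw [← dist_eq_norm]; exact (mem_ball.1 ht).le
  let S := {y : ℂ → E // y 0 = x₀ ∧ DifferentiableOn ℂ y (ball 0 r) ∧
    ∀ t ∈ ball (0 : ℂ) r, y t ∈ closedBall x₀ R}
  -- The Picard integral is a primitive of the holomorphic function `V ∘ y` on the disc, normalized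
  -- to `x₀` at `0`.
  have hstep : ∀ y : S, ∃ y' : S, ∀ t ∈ ball (0 : ℂ) r, HasDerivAt y'.1 (V (y.1 t)) t := by
    rintro ⟨y, hy0, hyd, hyR⟩
    have hVy : DifferentiableOn ℂ (fun t => V (y t)) (ball 0 r) := fun t ht =>
      (hball (hyR t ht)).2.comp_differentiableWithinAt t (hyd t ht)
    obtain ⟨g, hg0, hg⟩ := (hVy.isExactOn_ball).with_val_at 0 x₀
    refine ⟨⟨g, hg0, fun t ht => (hg t ht).differentiableAt.differentiableWithinAt, fun t ht => ?_⟩,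
      hg⟩
    have := (convex_ball (0 : ℂ) r).norm_image_sub_le_of_norm_hasDerivWithin_le
      (fun t ht => (hg t ht).hasDerivWithinAt) (fun t ht => hVM _ (hyR t ht)) h0 ht
    rw [mem_closedBall, dist_eq_norm, ← hg0]
    refine this.trans (le_trans ?_ hrM)
    gcongr
    exact hnorm t ht
  choose step hstep using hstep
  let y : ℕ → S := fun n => step^[n] ⟨fun _ => x₀, rfl, differentiableOn_const _, fun _ _ =>
    mem_closedBall_self hR.le⟩
  have hy : ∀ n, ∀ t ∈ ball (0 : ℂ) r, HasDerivAt (y (n + 1)).1 (V ((y n).1 t)) t := fun n t ht => by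
    simp only [y, Function.iterate_succ_apply']
    exact hstep _ t ht
  have hdiff : ∀ n, ∀ t ∈ ball (0 : ℂ) r,
      ‖(y n).1 t - (y (n + 1)).1 t‖ ≤ 2 * R * (1 / 2) ^ n := by
    intro n
    induction n with
    | zero =>
      intro t ht
      have h1 := (y 0).2.2.2 t ht
      have h2 := (y 1).2.2.2 t ht
      rw [← dist_eq_norm]
      have := dist_triangle_right ((y 0).1 t) ((y 1).1 t) x₀
      rw [mem_closedBall] at h1 h2
      simpa using by linarith
    | succ n ih =>
      intro t ht
      have hder : ∀ t ∈ ball (0 : ℂ) r, HasDerivWithinAt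
          (fun t => (y (n + 1)).1 t - (y (n + 1 + 1)).1 t)
          (V ((y n).1 t) - V ((y (n + 1)).1 t)) (ball 0 r) t := fun t ht =>
        ((hy n t ht).fun_sub (hy (n + 1) t ht)).hasDerivWithinAt
      have := (convex_ball (0 : ℂ) r).norm_image_sub_le_of_norm_hasDerivWithin_le hder
        (C := K * (2 * R * (1 / 2) ^ n)) (fun t ht => (hlip _ ((y n).2.2.2 t ht) _
          ((y (n + 1)).2.2.2 t ht)).trans (by gcongr; exact ih t ht)) h0 ht
      simp only [(y (n + 1)).2.1, (y (n + 1 + 1)).2.1, sub_self, sub_zero] at this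
      refine this.trans ?_
      have h1 : ‖t‖ ≤ r := by simpa using hnorm t ht
      calc K * (2 * R * (1 / 2) ^ n) * ‖t‖ ≤ K * (2 * R * (1 / 2) ^ n) * r := by gcongr
        _ = (K * r) * (2 * R * (1 / 2) ^ n) := by ring
        _ ≤ 1 / 2 * (2 * R * (1 / 2) ^ n) := by gcongr
        _ = _ := by ring
  have hlim : ∀ t, ∃ x, t ∈ ball (0 : ℂ) r → Tendsto (fun n => (y n).1 t) atTop (𝓝 x) := fun t => by
    by_cases ht : t ∈ ball (0 : ℂ) r
    · obtain ⟨x, hx⟩ := cauchySeq_tendsto_of_complete (cauchySeq_of_le_geometric (1 / 2) (2 * R)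
        (by norm_num) (f := fun n => (y n).1 t) fun n => by
          rw [dist_eq_norm]; exact hdiff n t ht)
      exact ⟨x, fun _ => hx⟩
    · exact ⟨0, fun h => (ht h).elim⟩
  choose c hc using hlim
  have hcR : ∀ t ∈ ball (0 : ℂ) r, c t ∈ closedBall x₀ R := fun t ht =>
    isClosed_closedBall.mem_of_tendsto (hc t ht) (Eventually.of_forall fun n => (y n).2.2.2 t ht)
  have hdist : ∀ n, ∀ t ∈ ball (0 : ℂ) r, ‖(y n).1 t - c t‖ ≤ 2 * R * (1 / 2) ^ n / (1 - 1 / 2) :=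
    fun n t ht => by
      rw [← dist_eq_norm]
      exact dist_le_of_le_geometric_of_tendsto (1 / 2) (2 * R) (by norm_num)
        (fun n => by rw [dist_eq_norm]; exact hdiff n t ht) (hc t ht) n
  refine ⟨r, hr0, c, ?_, fun t ht => ?_⟩
  · refine tendsto_nhds_unique (hc 0 h0) ?_
    simp only [fun n => (y n).2.1, tendsto_const_nhds]
  -- The derivatives `V(y n)` converge uniformly since `V` is Lipschitz, so the limit may be
  -- differentiated termwise.
  · refine hasDerivAt_of_tendstoUniformlyOn (l := atTop) (f := fun n => (y (n + 1)).1)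
      (f' := fun n t => V ((y n).1 t)) (g' := fun t => V (c t)) isOpen_ball ?_ (Eventually.of_forall hy)
      (fun t ht => (hc t ht).comp (tendsto_add_atTop_nat 1)) ht
    rw [Metric.tendstoUniformlyOn_iff]
    intro ε hε
    have hto : Tendsto (fun n : ℕ => K * (2 * R * (1 / 2 : ℝ) ^ n / (1 - 1 / 2))) atTop (𝓝 0) := by
      have h1 := tendsto_pow_atTop_nhds_zero_of_lt_one (r := (1 / 2 : ℝ)) (by norm_num) (by norm_num)
      simpa using ((h1.const_mul (2 * R)).div_const (1 - 1 / 2)).const_mul (K : ℝ)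
    filter_upwards [hto.eventually (gt_mem_nhds hε)] with n hn t ht
    rw [dist_comm, dist_eq_norm]
    refine lt_of_le_of_lt ((hlip _ ((y n).2.2.2 t ht) _ (hcR t ht)).trans ?_) hn
    gcongr
    exact hdist n t ht

end ComplexODE

/-! ### Derivatives at the identity and logarithmic derivatives -/

section LieGroupCalculus

open Filter

variable {E : Type*} [NormedAddCommGroup E] [NormedSpace ℂ E]
  {G : Type*} [TopologicalSpace G] [ChartedSpace E G] [Group G] [LieGroup 𝓘(ℂ, E) ω G]
  {W : Type*} [NormedAddCommGroup W] [NormedSpace ℂ W]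

variable (E G) in
/-- The preferred chart at the identity. -/
noncomputable abbrev unitChart : OpenPartialHomeomorph G E := chartAt E (1 : G)

omit [NormedSpace ℂ E] [LieGroup 𝓘(ℂ, E) ω G] in
theorem one_mem_chart_source : (1 : G) ∈ (unitChart E G).source := mem_chart_source E 1

omit [NormedSpace ℂ E] [LieGroup 𝓘(ℂ, E) ω G] in
theorem chart_one_mem_target : (unitChart E G) 1 ∈ (unitChart E G).target := mem_chart_target E 1

omit [NormedSpace ℂ E] [LieGroup 𝓘(ℂ, E) ω G] in
theorem chart_symm_chart_one : (unitChart E G).symm ((unitChart E G) 1) = 1 :=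
  (unitChart E G).left_inv one_mem_chart_source

omit [Group G] [LieGroup 𝓘(ℂ, E) ω G] in
theorem ContMDiffAt.contDiffAt_chart [IsManifold 𝓘(ℂ, E) ω G] {F : W → G} {w : W} {g : G}
    (hF : ContMDiffAt 𝓘(ℂ, W) 𝓘(ℂ, E) ω F w) (h : F w ∈ (chartAt E g).source) :
    ContDiffAt ℂ ω (fun x => chartAt E g (F x)) w :=
  ((contMDiffOn_chart.contMDiffAt ((chartAt E g).open_source.mem_nhds h)).comp w hF).contDiffAt

omit [Group G] [LieGroup 𝓘(ℂ, E) ω G] in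
theorem ContDiffAt.contMDiffAt_chart_symm [IsManifold 𝓘(ℂ, E) ω G] {c : W → E} {w : W} {g : G}
    (hc : ContDiffAt ℂ ω c w) (h : c w ∈ (chartAt E g).target) :
    ContMDiffAt 𝓘(ℂ, W) 𝓘(ℂ, E) ω (fun x => (chartAt E g).symm (c x)) w :=
  (contMDiffOn_chart_symm.contMDiffAt ((chartAt E g).open_target.mem_nhds h)).comp w hc.contMDiffAt

variable (E G) in
/-- The multiplication of `G` in the chart at `1`. -/
noncomputable def chartMul (p : E × E) : E := (unitChart E G) ((unitChart E G).symm p.1 * (unitChart E G).symm p.2)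

theorem contDiffAt_chartMul {p : E × E} (h1 : p.1 ∈ (unitChart E G).target) (h2 : p.2 ∈ (unitChart E G).target)
    (h : (unitChart E G).symm p.1 * (unitChart E G).symm p.2 ∈ (unitChart E G).source) :
    ContDiffAt ℂ ω (chartMul E G) p := by
  refine ContMDiffAt.contDiffAt_chart ?_ h
  exact (contDiffAt_fst.contMDiffAt_chart_symm h1).mul (contDiffAt_snd.contMDiffAt_chart_symm h2)

theorem contDiffAt_chartMul_left {x : E} (h : x ∈ (unitChart E G).target) :
    ContDiffAt ℂ ω (chartMul E G) (x, (unitChart E G) 1) :=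
  contDiffAt_chartMul h chart_one_mem_target (by
    simpa [chart_symm_chart_one] using (unitChart E G).map_target h)

theorem contDiffAt_chartMul_right {x : E} (h : x ∈ (unitChart E G).target) :
    ContDiffAt ℂ ω (chartMul E G) ((unitChart E G) 1, x) :=
  contDiffAt_chartMul chart_one_mem_target h (by
    simpa [chart_symm_chart_one] using (unitChart E G).map_target h)

omit [NormedSpace ℂ E] [LieGroup 𝓘(ℂ, E) ω G] in
theorem eventually_chartMul_one_right : ∀ᶠ x in 𝓝 ((unitChart E G) 1), chartMul E G (x, (unitChart E G) 1) = x := by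
  filter_upwards [(unitChart E G).open_target.mem_nhds chart_one_mem_target] with x hx
  simp only [chartMul, chart_symm_chart_one, mul_one, (unitChart E G).right_inv hx]

omit [NormedSpace ℂ E] [LieGroup 𝓘(ℂ, E) ω G] in
theorem eventually_chartMul_one_left : ∀ᶠ x in 𝓝 ((unitChart E G) 1), chartMul E G ((unitChart E G) 1, x) = x := by
  filter_upwards [(unitChart E G).open_target.mem_nhds chart_one_mem_target] with x hx
  simp only [chartMul, chart_symm_chart_one, one_mul, (unitChart E G).right_inv hx]

/-- Restricted to each factor, multiplication by `1` is the identity, so the derivative at `(1, 1)`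
is addition. -/
theorem hasFDerivAt_chartMul : HasFDerivAt (chartMul E G)
    (ContinuousLinearMap.fst ℂ E E + ContinuousLinearMap.snd ℂ E E) ((unitChart E G) 1, (unitChart E G) 1) := by
  have hd : DifferentiableAt ℂ (chartMul E G) ((unitChart E G) 1, (unitChart E G) 1) :=
    (contDiffAt_chartMul_left chart_one_mem_target).differentiableAt (by simp)
  have h := hd.hasFDerivAt
  have h1 : (fderiv ℂ (chartMul E G) ((unitChart E G) 1, (unitChart E G) 1)).comp (ContinuousLinearMap.inl ℂ E E)
      = ContinuousLinearMap.id ℂ E :=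
    (h.comp (f := fun x => (x, (unitChart E G) 1)) ((unitChart E G) 1)
      (hasFDerivAt_prodMk_left (𝕜 := ℂ) ((unitChart E G) 1) ((unitChart E G) 1))).unique
      ((hasFDerivAt_id _).congr_of_eventuallyEq eventually_chartMul_one_right)
  have h2 : (fderiv ℂ (chartMul E G) ((unitChart E G) 1, (unitChart E G) 1)).comp (ContinuousLinearMap.inr ℂ E E)
      = ContinuousLinearMap.id ℂ E :=
    (h.comp (f := fun x => ((unitChart E G) 1, x)) ((unitChart E G) 1)
      (hasFDerivAt_prodMk_right ((unitChart E G) 1) ((unitChart E G) 1))).unique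
      ((hasFDerivAt_id _).congr_of_eventuallyEq eventually_chartMul_one_left)
  convert h using 1
  ext v
  · simpa using congrArg (fun L => L v) h1.symm
  · simpa using congrArg (fun L => L v) h2.symm

/-- `u w = 1`, and `A` is the derivative of `u` at `w`, computed in the chart at `1`. -/
structure HasUnitDeriv (u : W → G) (A : W →L[ℂ] E) (w : W) : Prop where
  eq_one : u w = 1
  continuousAt : ContinuousAt u w
  hasFDerivAt : HasFDerivAt (fun x => (unitChart E G) (u x)) A w

namespace HasUnitDeriv

variable {u v : W → G} {A B : W →L[ℂ] E} {w : W}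

omit [LieGroup 𝓘(ℂ, E) ω G] in
theorem eventually_mem_source (hu : HasUnitDeriv u A w) : ∀ᶠ x in 𝓝 w, u x ∈ (unitChart E G).source :=
  hu.continuousAt.eventually ((unitChart E G).open_source.mem_nhds (hu.eq_one ▸ one_mem_chart_source))

theorem mul (hu : HasUnitDeriv u A w) (hv : HasUnitDeriv v B w) :
    HasUnitDeriv (fun x => u x * v x) (A + B) w where
  eq_one := by rw [hu.eq_one, hv.eq_one, one_mul]
  continuousAt := by
    have := topologicalGroup_of_lieGroup 𝓘(ℂ, E) ω (G := G)
    exact hu.continuousAt.mul hv.continuousAt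
  hasFDerivAt := by
    have h := hasFDerivAt_chartMul (E := E) (G := G)
    have h1 := hu.hasFDerivAt.prodMk hv.hasFDerivAt
    have h2 : HasFDerivAt (chartMul E G)
        (ContinuousLinearMap.fst ℂ E E + ContinuousLinearMap.snd ℂ E E)
        ((unitChart E G) (u w), (unitChart E G) (v w)) := by
      rw [hu.eq_one, hv.eq_one]; exact h
    have h3 := h2.comp w h1
    refine (h3.congr_of_eventuallyEq ?_).congr_fderiv ?_
    · filter_upwards [hu.eventually_mem_source, hv.eventually_mem_source] with x hx hx'
      simp only [Function.comp_apply, chartMul, (unitChart E G).left_inv hx, (unitChart E G).left_inv hx']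
    · ext z; simp

/-- Images of curves through `1` under a holomorphic map preserving `1`. -/
theorem map {T : G → G} (hT : ContMDiff 𝓘(ℂ, E) 𝓘(ℂ, E) ω T) (hT1 : T 1 = 1)
    (hu : HasUnitDeriv u A w) :
    HasUnitDeriv (fun x => T (u x)) ((fderiv ℂ (fun x => (unitChart E G) (T ((unitChart E G).symm x)))
      ((unitChart E G) 1)).comp A) w where
  eq_one := by rw [hu.eq_one, hT1]
  continuousAt := hT.continuous.continuousAt.comp hu.continuousAt
  hasFDerivAt := by
    have h1 : ContDiffAt ℂ ω (fun x => (unitChart E G) (T ((unitChart E G).symm x))) ((unitChart E G) 1) := by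
      refine ContMDiffAt.contDiffAt_chart ?_ ?_
      · exact hT.contMDiffAt.comp ((unitChart E G) 1)
          (contDiffAt_id.contMDiffAt_chart_symm chart_one_mem_target)
      · rw [chart_symm_chart_one, hT1]; exact one_mem_chart_source
    have h2 := (h1.differentiableAt (by simp)).hasFDerivAt
    rw [← hu.eq_one] at h2
    have h3 := h2.comp w hu.hasFDerivAt
    rw [hu.eq_one] at h3
    refine h3.congr_of_eventuallyEq ?_
    filter_upwards [hu.eventually_mem_source] with x hx
    simp only [Function.comp_apply, (unitChart E G).left_inv hx]

omit [LieGroup 𝓘(ℂ, E) ω G] in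
theorem unique (hu : HasUnitDeriv u A w) (hu' : HasUnitDeriv u B w) : A = B :=
  hu.hasFDerivAt.unique hu'.hasFDerivAt

omit [LieGroup 𝓘(ℂ, E) ω G] in
theorem one : HasUnitDeriv (fun _ : W => (1 : G)) (0 : W →L[ℂ] E) w :=
  ⟨rfl, continuousAt_const, hasFDerivAt_const _ _⟩

omit [LieGroup 𝓘(ℂ, E) ω G] in
theorem congr (hu : HasUnitDeriv u A w) (h : v =ᶠ[𝓝 w] u) : HasUnitDeriv v A w :=
  ⟨h.self_of_nhds.trans hu.eq_one, hu.continuousAt.congr h.symm,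
    hu.hasFDerivAt.congr_of_eventuallyEq (h.mono fun x hx => by simp only [hx])⟩

omit [LieGroup 𝓘(ℂ, E) ω G] in
theorem chart_symm : HasUnitDeriv (fun x => (unitChart E G).symm x) (ContinuousLinearMap.id ℂ E) ((unitChart E G) 1) where
  eq_one := chart_symm_chart_one
  continuousAt := (unitChart E G).continuousAt_symm chart_one_mem_target
  hasFDerivAt := (hasFDerivAt_id _).congr_of_eventuallyEq (by
    filter_upwards [(unitChart E G).open_target.mem_nhds chart_one_mem_target] with x hx
    simp [(unitChart E G).right_inv hx])

theorem inv (hu : HasUnitDeriv u A w) : HasUnitDeriv (fun x => (u x)⁻¹) (-A) w := by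
  have h1 := hu.map (contMDiff_inv 𝓘(ℂ, E) ω) inv_one
  have h2 := (hu.mul h1).unique (one.congr (by simp))
  rwa [← eq_neg_of_add_eq_zero_right h2]

omit [LieGroup 𝓘(ℂ, E) ω G] in
theorem comp {W' : Type*} [NormedAddCommGroup W'] [NormedSpace ℂ W'] {f : W' → W} {f' : W' →L[ℂ] W}
    {w' : W'} (hu : HasUnitDeriv u A w) (hf : HasFDerivAt f f' w') (hw : f w' = w) :
    HasUnitDeriv (fun x => u (f x)) (A.comp f') w' := by
  subst hw
  exact ⟨hu.eq_one, hu.continuousAt.comp hf.continuousAt, hu.hasFDerivAt.comp w' hf⟩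

end HasUnitDeriv

variable (E) in
/-- The adjoint action of `g` on the tangent space at `1`, in the chart at `1`. -/
noncomputable def lieAd (g : G) : E →L[ℂ] E :=
  fderiv ℂ (fun x => (unitChart E G) (g * (unitChart E G).symm x * g⁻¹)) ((unitChart E G) 1)

theorem HasUnitDeriv.conj {u : W → G} {A : W →L[ℂ] E} {w : W} (hu : HasUnitDeriv u A w) (g : G) :
    HasUnitDeriv (fun x => g * u x * g⁻¹) ((lieAd E g).comp A) w :=
  hu.map (T := fun x => g * x * g⁻¹) ((contMDiff_const.mul contMDiff_id).mul contMDiff_const)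
    (by simp)

theorem lieAd_mul (g h : G) : lieAd E (g * h) = lieAd E g * lieAd E h := by
  have h1 := (HasUnitDeriv.chart_symm (E := E) (G := G)).conj (g * h)
  have h2 := ((HasUnitDeriv.chart_symm (E := E) (G := G)).conj h).conj g
  have := h1.unique (h2.congr (Eventually.of_forall fun x => by simp [mul_assoc]))
  rwa [ContinuousLinearMap.comp_id, ContinuousLinearMap.comp_id] at this

theorem lieAd_one : lieAd E (1 : G) = 1 := by
  have h1 := (HasUnitDeriv.chart_symm (E := E) (G := G)).conj 1
  have := h1.unique (HasUnitDeriv.chart_symm.congr (Eventually.of_forall fun x => by simp))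
  rwa [ContinuousLinearMap.comp_id] at this

/-- The logarithmic derivative `u⁻¹ u'` of the curve `u` at `t` is `v`. -/
def HasLogDeriv (u : ℂ → G) (v : E) (t : ℂ) : Prop :=
  HasUnitDeriv (fun s => (u t)⁻¹ * u s) (ContinuousLinearMap.toSpanSingleton ℂ v) t

namespace HasLogDeriv

variable {u u₁ u₂ : ℂ → G} {v v₁ v₂ : E} {t : ℂ}

/-- `(u₁(t) u₂(t))⁻¹ u₁(s) u₂(s)` is `u₁(t)⁻¹ u₁(s)` conjugated by `u₂(t)⁻¹`, times `u₂(t)⁻¹ u₂(s)`.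
-/
theorem mul (h₁ : HasLogDeriv u₁ v₁ t) (h₂ : HasLogDeriv u₂ v₂ t) :
    HasLogDeriv (fun s => u₁ s * u₂ s) (lieAd E (u₂ t)⁻¹ v₁ + v₂) t := by
  have h := (HasUnitDeriv.conj h₁ (u₂ t)⁻¹).mul h₂
  have e : (lieAd E (u₂ t)⁻¹).comp (ContinuousLinearMap.toSpanSingleton ℂ v₁) +
      ContinuousLinearMap.toSpanSingleton ℂ v₂ =
      ContinuousLinearMap.toSpanSingleton ℂ (lieAd E (u₂ t)⁻¹ v₁ + v₂) := by
    ext; simp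
  rw [e] at h
  exact h.congr (Eventually.of_forall fun x => by simp [mul_assoc])

theorem inv (h : HasLogDeriv u v t) : HasLogDeriv (fun s => (u s)⁻¹) (-lieAd E (u t) v) t := by
  have h := (HasUnitDeriv.conj h (u t)).inv
  have e : -((lieAd E (u t)).comp (ContinuousLinearMap.toSpanSingleton ℂ v)) =
      ContinuousLinearMap.toSpanSingleton ℂ (-lieAd E (u t) v) := by
    ext; simp
  rw [e] at h
  exact h.congr (Eventually.of_forall fun x => by simp)

theorem mul_inv (h₁ : HasLogDeriv u₁ v t) (h₂ : HasLogDeriv u₂ v t) :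
    HasLogDeriv (fun s => u₁ s * (u₂ s)⁻¹) (0 : E) t := by
  have := h₁.mul h₂.inv
  simpa using this

omit [LieGroup 𝓘(ℂ, E) ω G] in
theorem const_mul (h : HasLogDeriv u v t) (g : G) : HasLogDeriv (fun s => g * u s) v t :=
  HasUnitDeriv.congr h (Eventually.of_forall fun x => by simp)

omit [LieGroup 𝓘(ℂ, E) ω G] in
theorem congr (h : HasLogDeriv u₁ v t) (h' : u₂ =ᶠ[𝓝 t] u₁) : HasLogDeriv u₂ v t :=
  HasUnitDeriv.congr h (h'.mono fun x hx => by simp only [hx, h'.self_of_nhds])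

omit [LieGroup 𝓘(ℂ, E) ω G] in
theorem comp_add {s : ℂ} (h : HasLogDeriv u v (s + t)) : HasLogDeriv (fun t => u (s + t)) v t := by
  have h := HasUnitDeriv.comp h ((hasFDerivAt_id t).const_add s) rfl
  simpa [HasLogDeriv] using h

/-- Translates the intrinsic notion, whose base point moves with `t`, into an ordinary derivative in
one fixed chart. -/
theorem hasDerivAt_chart (h : HasLogDeriv u v t) {g : G} (hg : g * u t ∈ (unitChart E G).source) :
    HasDerivAt (fun s => (unitChart E G) (g * u s))
      (fderiv ℂ (fun z => (unitChart E G) (g * u t * (unitChart E G).symm z)) ((unitChart E G) 1) v) t := by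
  have h1 : ContDiffAt ℂ ω (fun z => (unitChart E G) (g * u t * (unitChart E G).symm z)) ((unitChart E G) 1) := by
    refine ContMDiffAt.contDiffAt_chart ?_ ?_
    · exact contMDiffAt_const.mul (contDiffAt_id.contMDiffAt_chart_symm chart_one_mem_target)
    · rw [chart_symm_chart_one, mul_one]; exact hg
  have h2 := (h1.differentiableAt (by simp)).hasFDerivAt
  have h0 := HasUnitDeriv.eq_one h
  rw [← h0] at h2
  have h3 := h2.comp t (HasUnitDeriv.hasFDerivAt h)
  rw [h0] at h3
  rw [hasDerivAt_iff_hasFDerivAt]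
  refine (h3.congr_of_eventuallyEq ?_).congr_fderiv ?_
  · filter_upwards [HasUnitDeriv.eventually_mem_source h] with x hx
    simp only [Function.comp_apply, (unitChart E G).left_inv hx]
    group
  · ext; simp

/-- Near each point the translated curve stays in the chart, where its ordinary derivative is `0`;
local constancy spreads over the preconnected set. -/
theorem eq_of_zero {S : Set ℂ} (hS : IsOpen S) (hS' : IsPreconnected S)
    (h : ∀ t ∈ S, HasLogDeriv u (0 : E) t) {s t : ℂ} (hs : s ∈ S) (ht : t ∈ S) : u s = u t := by
  have := topologicalGroup_of_lieGroup 𝓘(ℂ, E) ω (G := G)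
  refine hS'.induction₂ (fun s t => u s = u t) ?_ (fun _ _ _ _ _ _ => Eq.trans)
    (fun _ _ _ _ => Eq.symm) hs ht
  intro t₀ ht₀
  have hc : ∀ᶠ s in 𝓝 t₀, s ∈ S ∧ (u t₀)⁻¹ * u s ∈ (unitChart E G).source :=
    (hS.eventually_mem ht₀).and (HasUnitDeriv.eventually_mem_source (h t₀ ht₀))
  obtain ⟨r, hr, hball⟩ := Metric.eventually_nhds_iff_ball.1 hc
  refine mem_nhdsWithin_of_mem_nhds (mem_of_superset (Metric.ball_mem_nhds t₀ hr) fun s hs => ?_)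
  have hd : ∀ s ∈ Metric.ball t₀ r, HasDerivAt (fun s => (unitChart E G) ((u t₀)⁻¹ * u s)) 0 s := fun s hs => by
    have := (h s (hball s hs).1).hasDerivAt_chart (hball s hs).2
    simpa using this
  have := Metric.isOpen_ball.is_const_of_deriv_eq_zero (convex_ball t₀ r).isPreconnected
    (fun s hs => (hd s hs).differentiableAt.differentiableWithinAt) (fun s hs => (hd s hs).deriv)
    hs (Metric.mem_ball_self hr)
  have := (unitChart E G).injOn (hball s hs).2 (hball t₀ (Metric.mem_ball_self hr)).2 this
  exact (mul_left_cancel this).symm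

/-- Uniqueness for `u⁻¹ u' = v`: the quotient `u₁ u₂⁻¹` has logarithmic derivative `0`. -/
theorem eq_of_eq {S : Set ℂ} (hS : IsOpen S) (hS' : IsPreconnected S)
    (h₁ : ∀ t ∈ S, HasLogDeriv u₁ v t) (h₂ : ∀ t ∈ S, HasLogDeriv u₂ v t) {s t : ℂ} (hs : s ∈ S)
    (hst : u₁ s = u₂ s) (ht : t ∈ S) : u₁ t = u₂ t := by
  have := eq_of_zero hS hS' (fun t ht => (h₁ t ht).mul_inv (h₂ t ht)) ht hs
  rw [hst, mul_inv_cancel] at this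
  exact mul_inv_eq_one.1 this

end HasLogDeriv

end LieGroupCalculus

/-! ### Existence and uniqueness of holomorphic one-parameter subgroups -/

section OneParameterSubgroups

open Filter Metric

variable {E : Type*} [NormedAddCommGroup E] [NormedSpace ℂ E]
  {G : Type*} [TopologicalSpace G] [ChartedSpace E G] [Group G] [LieGroup 𝓘(ℂ, E) ω G]

/-- The hypothesis says that `c` follows the left-invariant field of `v` in the chart. Left
translation by `g⁻¹` has a derivative `B` inverting that of `z ↦ g z` at `1`, so it carries `c'`
back to `v`. -/
theorem hasLogDeriv_chart_symm {c : ℂ → E} {v : E} {t : ℂ} (hct : c t ∈ (unitChart E G).target)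
    (hc : HasDerivAt c (fderiv ℂ (chartMul E G) (c t, unitChart E G 1) (0, v)) t) :
    HasLogDeriv (fun s => (unitChart E G).symm (c s)) v t := by
  have := topologicalGroup_of_lieGroup 𝓘(ℂ, E) ω (G := G)
  set g := (unitChart E G).symm (c t) with hg
  have hcont : ContinuousAt (fun s => (unitChart E G).symm (c s)) t :=
    ContinuousAt.comp (f := c) ((unitChart E G).continuousAt_symm hct) hc.continuousAt
  refine ⟨inv_mul_cancel _, continuousAt_const.mul hcont, ?_⟩
  have hF : ContDiffAt ℂ ω (fun x => unitChart E G (g⁻¹ * (unitChart E G).symm x)) (c t) := by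
    refine ContMDiffAt.contDiffAt_chart ?_ ?_
    · exact contMDiffAt_const.mul (contDiffAt_id.contMDiffAt_chart_symm hct)
    · rw [← hg, inv_mul_cancel]; exact one_mem_chart_source
  have hB := (hF.differentiableAt (by simp)).hasFDerivAt
  set B := fderiv ℂ (fun x => unitChart E G (g⁻¹ * (unitChart E G).symm x)) (c t)
  have hm := ((contDiffAt_chartMul_left hct).differentiableAt (by simp)).hasFDerivAt
  have hm' := hm.comp (f := fun z => (c t, z)) (unitChart E G 1)
    (hasFDerivAt_prodMk_right (𝕜 := ℂ) (c t) (unitChart E G 1))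
  have hval : chartMul E G (c t, unitChart E G 1) = c t := by
    simp only [chartMul, chart_symm_chart_one, mul_one, (unitChart E G).right_inv hct]
  have hBm : HasFDerivAt (fun z => unitChart E G (g⁻¹ * (unitChart E G).symm (chartMul E G (c t, z))))
      (B.comp ((fderiv ℂ (chartMul E G) (c t, unitChart E G 1)).comp
        (ContinuousLinearMap.inr ℂ E E))) (unitChart E G 1) := by
    refine HasFDerivAt.comp (g := fun x => unitChart E G (g⁻¹ * (unitChart E G).symm x))
      (f := fun z => chartMul E G (c t, z)) _ ?_ hm'
    rw [hval]; exact hB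
  have hid : B.comp ((fderiv ℂ (chartMul E G) (c t, unitChart E G 1)).comp
        (ContinuousLinearMap.inr ℂ E E)) = ContinuousLinearMap.id ℂ E := by
    refine hBm.unique ((hasFDerivAt_id _).congr_of_eventuallyEq ?_)
    have h1 : ∀ᶠ z in 𝓝 (unitChart E G 1), g * (unitChart E G).symm z ∈ (unitChart E G).source := by
      have : ContinuousAt (fun z => g * (unitChart E G).symm z) (unitChart E G 1) :=
        continuousAt_const.mul ((unitChart E G).continuousAt_symm chart_one_mem_target)
      refine this.eventually ((unitChart E G).open_source.mem_nhds ?_)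
      change g * (unitChart E G).symm (unitChart E G 1) ∈ _
      rw [chart_symm_chart_one, mul_one]
      exact (unitChart E G).map_target hct
    filter_upwards [h1, (unitChart E G).open_target.mem_nhds chart_one_mem_target] with z hz hz'
    simp only [chartMul, ← hg, (unitChart E G).left_inv hz, inv_mul_cancel_left,
      (unitChart E G).right_inv hz', id]
  have := hB.comp_hasDerivAt t hc
  rw [hasDerivAt_iff_hasFDerivAt] at this
  refine this.congr_fderiv ?_
  congr 1
  have := congrArg (fun L => L v) hid
  simpa using this

theorem exists_local_hasLogDeriv [CompleteSpace E] (v : E) :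
    ∃ r > 0, ∃ y : ℂ → G, y 0 = 1 ∧ ∀ t ∈ ball (0 : ℂ) r, HasLogDeriv y v t := by
  have hV : ContDiffAt ℂ 1 (fun x => fderiv ℂ (chartMul E G) (x, unitChart E G 1) (0, v))
      (unitChart E G 1) := by
    have h1 : ContDiffAt ℂ 1 (fderiv ℂ (chartMul E G)) (unitChart E G 1, unitChart E G 1) :=
      (contDiffAt_chartMul_left chart_one_mem_target).fderiv_right (by simp)
    exact (h1.comp (f := fun x => (x, unitChart E G 1)) (unitChart E G 1)
      (contDiffAt_id.prodMk contDiffAt_const)).clm_apply contDiffAt_const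
  obtain ⟨r, hr, c, hc0, hc⟩ := exists_hasDerivAt_complex_of_contDiffAt hV
  have hcont : ∀ᶠ t in 𝓝 (0 : ℂ), c t ∈ (unitChart E G).target := by
    refine (hc 0 (mem_ball_self hr)).continuousAt.eventually
      ((unitChart E G).open_target.mem_nhds ?_)
    rw [hc0]; exact chart_one_mem_target
  obtain ⟨r', hr', hball⟩ := Metric.eventually_nhds_iff_ball.1
    (hcont.and (ball_mem_nhds (0 : ℂ) hr))
  refine ⟨r', hr', fun t => (unitChart E G).symm (c t), ?_, fun t ht => ?_⟩
  · simp only [hc0, chart_symm_chart_one]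
  · exact hasLogDeriv_chart_symm (hball t ht).1 (hc t (hball t ht).2)

/-- For fixed `s` both sides solve the same equation in `t` and agree at `t = 0`. -/
theorem HasLogDeriv.map_add_of_ball {y : ℂ → G} {v : E} {r : ℝ} (h0 : y 0 = 1)
    (h : ∀ t ∈ ball (0 : ℂ) r, HasLogDeriv y v t) {s t : ℂ} (hst : ‖s‖ + ‖t‖ < r) :
    y (s + t) = y s * y t := by
  refine HasLogDeriv.eq_of_eq (E := E) (u₁ := fun t => y (s + t)) (u₂ := fun t => y s * y t)
    (isOpen_ball (x := (0 : ℂ)) (ε := r - ‖s‖)) (convex_ball _ _).isPreconnected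
    (v := v) (fun t ht => (h (s + t) ?_).comp_add) (fun t ht => (h t ?_).const_mul _) (s := 0) ?_ ?_ ?_
  · rw [mem_ball_zero_iff] at ht ⊢
    linarith [norm_add_le s t]
  · rw [mem_ball_zero_iff] at ht ⊢
    linarith [norm_nonneg s]
  · rw [mem_ball_zero_iff, norm_zero]
    linarith [norm_nonneg t]
  · simp [h0]
  · rw [mem_ball_zero_iff]; linarith

/-- The extension is `t ↦ y(t/2)²`. With `a = t₀/2` and `d = (t - t₀)/2`, `y(a)` and `y(d)` commute,
so `y(a)⁻² y(a + d)² = y(2d) = y(t - t₀)`, whose derivative at `t₀` is `v`. -/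
theorem exists_hasLogDeriv_double {v : E} {r : ℝ} (hr : 0 < r)
    (h : ∃ y : ℂ → G, y 0 = 1 ∧ ∀ t ∈ ball (0 : ℂ) r, HasLogDeriv y v t) :
    ∃ y : ℂ → G, y 0 = 1 ∧ ∀ t ∈ ball (0 : ℂ) (2 * r), HasLogDeriv y v t := by
  obtain ⟨y, h0, hy⟩ := h
  refine ⟨fun t => y (t / 2) * y (t / 2), by simp [h0], fun t₀ ht₀ => ?_⟩
  have hadd : ∀ {s t : ℂ}, ‖s‖ + ‖t‖ < r → y (s + t) = y s * y t :=
    HasLogDeriv.map_add_of_ball h0 hy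
  have h1 : HasUnitDeriv y (ContinuousLinearMap.toSpanSingleton ℂ v) 0 :=
    HasUnitDeriv.congr (hy 0 (mem_ball_self hr)) (Eventually.of_forall fun x => by simp [h0])
  have h2 := h1.comp ((hasFDerivAt_id t₀).sub_const t₀) (by simp)
  have h3 : (ContinuousLinearMap.toSpanSingleton ℂ v).comp (ContinuousLinearMap.id ℂ ℂ) =
    ContinuousLinearMap.toSpanSingleton ℂ v := by ext; simp
  rw [h3] at h2
  refine h2.congr ?_
  rw [mem_ball_zero_iff] at ht₀
  have h4 : 0 < min (2 * r - ‖t₀‖) r := lt_min (by linarith) hr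
  filter_upwards [ball_mem_nhds t₀ h4] with t ht
  rw [mem_ball, dist_eq_norm, lt_min_iff] at ht
  set a := t₀ / 2 with ha
  set d := (t - t₀) / 2 with hd
  have hna : ‖a‖ = ‖t₀‖ / 2 := by rw [ha, norm_div]; simp
  have hnd : ‖d‖ = ‖t - t₀‖ / 2 := by rw [hd, norm_div]; simp
  have e1 : t / 2 = a + d := by rw [ha, hd]; ring
  have e2 : t - t₀ = d + d := by rw [hd]; ring
  have e3 : y (a + d) = y a * y d := hadd (by rw [hna, hnd]; linarith)
  have e4 : y (a + d) = y d * y a := by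
    rw [add_comm]; exact hadd (by rw [hna, hnd]; linarith)
  simp only [id]
  rw [e1, e2, hadd (s := d) (by rw [hnd]; linarith)]
  rw [inv_mul_eq_iff_eq_mul]
  have e5 : y d * y a = y a * y d := e4.symm.trans e3
  rw [e3]
  calc y a * y d * (y a * y d) = y a * (y d * y a) * y d := by simp only [mul_assoc]
    _ = y a * (y a * y d) * y d := by rw [e5]
    _ = _ := by simp only [mul_assoc]

variable (G) in
theorem exists_hasLogDeriv [CompleteSpace E] (v : E) :
    ∃ γ : ℂ → G, γ 0 = 1 ∧ ∀ t, HasLogDeriv γ v t := by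
  obtain ⟨r, hr, hy⟩ := exists_local_hasLogDeriv (G := G) v
  have h2 : ∀ n : ℕ, ∃ y : ℂ → G, y 0 = 1 ∧ ∀ t ∈ ball (0 : ℂ) (2 ^ n * r), HasLogDeriv y v t := by
    intro n
    induction n with
    | zero => simpa using hy
    | succ n ih =>
      have := exists_hasLogDeriv_double (by positivity) ih
      rwa [← mul_assoc, ← pow_succ'] at this
  have h3 : ∀ n : ℕ, ∃ y : ℂ → G, y 0 = 1 ∧ ∀ t ∈ ball (0 : ℂ) n, HasLogDeriv y v t := fun n => by
    obtain ⟨k, hk⟩ := pow_unbounded_of_one_lt (n / r) (one_lt_two (α := ℝ))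
    obtain ⟨y, hy0, hy⟩ := h2 k
    refine ⟨y, hy0, fun t ht => hy t (ball_subset_ball ?_ ht)⟩
    rw [div_lt_iff₀ hr] at hk
    exact hk.le
  choose Y hY0 hY using h3
  have hagree : ∀ {m n : ℕ}, m ≤ n → ∀ t ∈ ball (0 : ℂ) m, Y m t = Y n t := fun {m n} hmn t ht =>
    HasLogDeriv.eq_of_eq (E := E) isOpen_ball (convex_ball (0 : ℂ) m).isPreconnected (hY m)
      (fun t ht => hY n t (ball_subset_ball (by exact_mod_cast hmn) ht)) (s := 0)
      (mem_ball_self (lt_of_le_of_lt dist_nonneg ht)) (by rw [hY0, hY0]) ht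
  have hmem : ∀ t : ℂ, t ∈ ball (0 : ℂ) ((⌈‖t‖⌉₊ + 1 : ℕ) : ℝ) := fun t => by
    rw [mem_ball_zero_iff]
    push_cast
    linarith [Nat.le_ceil ‖t‖]
  refine ⟨fun t => Y (⌈‖t‖⌉₊ + 1) t, hY0 _, fun t₀ => ?_⟩
  -- One more than the index used at `t₀`: points within distance `1` of `t₀` may need it, and all
  -- their solutions agree with `Y N`.
  set N := ⌈‖t₀‖⌉₊ + 2 with hN
  have hle := Nat.le_ceil ‖t₀‖
  refine (hY N t₀ ?_).congr ?_
  · rw [mem_ball_zero_iff, hN]; push_cast; linarith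
  · filter_upwards [ball_mem_nhds t₀ one_pos] with t ht
    refine hagree ?_ t (hmem t)
    rw [hN, Nat.add_le_add_iff_right (n := 1) (m := ⌈‖t‖⌉₊) (k := ⌈‖t₀‖⌉₊ + 1), Nat.ceil_le]
    rw [mem_ball, dist_eq_norm] at ht
    push_cast
    linarith [norm_le_norm_add_norm_sub' t t₀]

theorem HasLogDeriv.map_add {γ : ℂ → G} {v : E} (h0 : γ 0 = 1) (h : ∀ t, HasLogDeriv γ v t)
    (s t : ℂ) : γ (s + t) = γ s * γ t :=
  HasLogDeriv.map_add_of_ball (E := E) (r := ‖s‖ + ‖t‖ + 1) h0 (fun t _ => h t) (by linarith)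

/-- In the translated chart the curve is complex differentiable on a disc, hence analytic. -/
theorem HasLogDeriv.contMDiff [CompleteSpace E] {γ : ℂ → G} {v : E} (h : ∀ t, HasLogDeriv γ v t) :
    ContMDiff 𝓘(ℂ, ℂ) 𝓘(ℂ, E) ω γ := by
  intro t₀
  have hev := HasUnitDeriv.eventually_mem_source (h t₀)
  obtain ⟨r, hr, hball⟩ := Metric.eventually_nhds_iff_ball.1 hev
  have hd : DifferentiableOn ℂ (fun s => unitChart E G ((γ t₀)⁻¹ * γ s)) (ball t₀ r) := fun s hs =>
    ((h s).hasDerivAt_chart (hball s hs)).differentiableAt.differentiableWithinAt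
  have hc : ContDiffAt ℂ ω (fun s => unitChart E G ((γ t₀)⁻¹ * γ s)) t₀ :=
    (hd.analyticAt (ball_mem_nhds t₀ hr)).contDiffAt
  have := (contMDiffAt_const (I := 𝓘(ℂ, ℂ)) (I' := 𝓘(ℂ, E)) (n := ω) (c := γ t₀)).mul
    (hc.contMDiffAt_chart_symm
    ((unitChart E G).map_source (hball t₀ (mem_ball_self hr))))
  refine this.congr_of_eventuallyEq ?_
  filter_upwards [hev] with s hs
  simp [(unitChart E G).left_inv hs]

omit [LieGroup 𝓘(ℂ, E) ω G] in
theorem HasLogDeriv.comp_mul {γ : ℂ → G} {v : E} (h : ∀ t, HasLogDeriv γ v t) (a : ℂ) (t : ℂ) :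
    HasLogDeriv (fun t => γ (a * t)) (a • v) t := by
  have h1 := HasUnitDeriv.comp (h (a * t)) ((hasFDerivAt_id t).const_mul a) rfl
  have h2 : (ContinuousLinearMap.toSpanSingleton ℂ v).comp (a • ContinuousLinearMap.id ℂ ℂ) =
    ContinuousLinearMap.toSpanSingleton ℂ (a • v) := by ext; simp
  rw [h2] at h1
  exact h1

omit [LieGroup 𝓘(ℂ, E) ω G] in
theorem MDifferentiableAt.hasDerivAt_unitChart {γ : ℂ → G}
    (h : MDifferentiableAt 𝓘(ℂ, ℂ) 𝓘(ℂ, E) γ 0) (h0 : γ 0 = 1) :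
    HasDerivAt (fun x => unitChart E G (γ x)) (mfderiv 𝓘(ℂ, ℂ) 𝓘(ℂ, E) γ 0 (1 : ℂ) : E) 0 := by
  obtain ⟨D, hD⟩ : ∃ D : ℂ →L[ℂ] E, D = mfderiv 𝓘(ℂ, ℂ) 𝓘(ℂ, E) γ 0 := ⟨_, rfl⟩
  have hd : HasFDerivWithinAt (writtenInExtChartAt 𝓘(ℂ, ℂ) 𝓘(ℂ, E) 0 γ)
    D (Set.range 𝓘(ℂ, ℂ)) (extChartAt 𝓘(ℂ, ℂ) (0 : ℂ) 0) := hD ▸ h.hasMFDerivAt.2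
  have e : writtenInExtChartAt 𝓘(ℂ, ℂ) 𝓘(ℂ, E) 0 γ = fun x => unitChart E G (γ x) := by
    ext x
    simp only [writtenInExtChartAt, h0, mfld_simps]
    rfl
  rw [e, ModelWithCorners.range_eq_univ, hasFDerivWithinAt_univ] at hd
  have h1 : (mfderiv 𝓘(ℂ, ℂ) 𝓘(ℂ, E) γ 0 (1 : ℂ) : E) = D 1 := by
    rw [hD]; rfl
  rw [h1]
  exact hd.hasDerivAt

omit [LieGroup 𝓘(ℂ, E) ω G] in
theorem IsOneParameterSubgroup.map_zero {v : GroupLieAlgebra 𝓘(ℂ, E) G} {γ : ℂ → G}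
    (h : IsOneParameterSubgroup v γ) : γ 0 = 1 := by
  have := h.map_add 0 0
  rw [add_zero] at this
  exact left_eq_mul.1 this

omit [LieGroup 𝓘(ℂ, E) ω G] in
theorem IsOneParameterSubgroup.hasLogDeriv {v : E} {γ : ℂ → G}
    (h : IsOneParameterSubgroup (E := E) (G := G) v γ) (t : ℂ) : HasLogDeriv γ v t := by
  have h0 := h.map_zero
  have h1 : HasUnitDeriv γ (ContinuousLinearMap.toSpanSingleton ℂ v) 0 := by
    refine ⟨h0, h.holomorphic.continuous.continuousAt, ?_⟩
    have := ((h.holomorphic 0).mdifferentiableAt (by simp)).hasDerivAt_unitChart h0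
    rw [h.deriv_zero] at this
    exact this.hasFDerivAt
  have h2 := h1.comp ((hasFDerivAt_id t).sub_const t) (by simp)
  have h3 : (ContinuousLinearMap.toSpanSingleton ℂ v).comp (ContinuousLinearMap.id ℂ ℂ) =
    ContinuousLinearMap.toSpanSingleton ℂ v := by ext; simp
  rw [h3] at h2
  refine h2.congr (Eventually.of_forall fun s => ?_)
  have := h.map_add t (s - t)
  rw [add_sub_cancel] at this
  simp [this]

theorem HasLogDeriv.isOneParameterSubgroup [CompleteSpace E] {v : E} {γ : ℂ → G} (h0 : γ 0 = 1)
    (h : ∀ t, HasLogDeriv γ v t) : IsOneParameterSubgroup (E := E) (G := G) v γ := by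
  refine ⟨HasLogDeriv.contMDiff h, HasLogDeriv.map_add h0 h, ?_⟩
  have hd := (((HasLogDeriv.contMDiff h) 0).mdifferentiableAt (by simp)).hasDerivAt_unitChart h0
  have h1 : HasUnitDeriv γ (ContinuousLinearMap.toSpanSingleton ℂ v) 0 :=
    HasUnitDeriv.congr (h 0) (Eventually.of_forall fun x => by simp [h0])
  exact hd.unique (by simpa using h1.hasFDerivAt.hasDerivAt)

/-- By uniqueness, the one-parameter subgroup chosen in `lieExp` may be replaced by any solution
`γ`. -/
theorem lieExp_eq [CompleteSpace E] {v : E} {γ : ℂ → G} (h0 : γ 0 = 1)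
    (h : ∀ t, HasLogDeriv γ v t) : lieExp (E := E) (G := G) v = γ 1 := by
  have hex : ∃ γ : ℂ → G, IsOneParameterSubgroup (E := E) (G := G) v γ :=
    ⟨γ, HasLogDeriv.isOneParameterSubgroup h0 h⟩
  refine (dif_pos hex : lieExp (E := E) (G := G) v = hex.choose 1).trans ?_
  exact HasLogDeriv.eq_of_eq (E := E) isOpen_univ isPreconnected_univ
    (fun t _ => hex.choose_spec.hasLogDeriv t) (fun t _ => h t) (s := 0) trivial
    (by rw [hex.choose_spec.map_zero, h0]) trivial

theorem lieExp_smul_eq [CompleteSpace E] {v : E} {γ : ℂ → G} (h0 : γ 0 = 1)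
    (h : ∀ t, HasLogDeriv γ v t) (a : ℂ) : lieExp (E := E) (G := G) (a • v : E) = γ a := by
  rw [lieExp_eq (γ := fun t => γ (a * t)) (by simpa using h0) (HasLogDeriv.comp_mul h a), mul_one]

end OneParameterSubgroups

/-- Near `x`, `R = Q⁻¹ P`, and inversion has derivative `-1` at the identity. -/
theorem hasFDerivAt_of_eventually_eq_mul {V A : Type*} [NormedAddCommGroup V] [NormedSpace ℂ V]
    [NormedRing A] [NormedAlgebra ℂ A] [CompleteSpace A] {P Q R : V → A} {P' Q' : V →L[ℂ] A} {x : V}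
    (hP : HasFDerivAt P P' x) (hQ : HasFDerivAt Q Q' x) (hP1 : P x = 1) (hQ1 : Q x = 1)
    (h : ∀ᶠ y in 𝓝 x, P y = Q y * R y) : HasFDerivAt R (P' - Q') x := by
  have hI := hasFDerivAt_ringInverse (𝕜 := ℂ) (1 : Aˣ)
  rw [Units.val_one, ← hQ1] at hI
  refine (((hI.comp _ hQ).mul' hP).congr_of_eventuallyEq ?_).congr_fderiv ?_
  · have hu : ∀ᶠ y in 𝓝 x, IsUnit (Q y) :=
      hQ.continuousAt.eventually (Units.isOpen.mem_nhds (hQ1 ▸ isUnit_one))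
    filter_upwards [hu, h] with y hy hy'
    simp only [Pi.mul_apply, Function.comp_apply, hy', ← mul_assoc, Ring.inverse_mul_cancel _ hy,
      one_mul]
  · ext v
    simp [hP1, hQ1, sub_eq_add_neg]

/-! ### The adjoint representation and `Ad(exp v) = exp(ad v)` -/

section Adjoint

open Filter

variable {E : Type*} [NormedAddCommGroup E] [NormedSpace ℂ E]
  {G : Type*} [TopologicalSpace G] [ChartedSpace E G] [Group G] [LieGroup 𝓘(ℂ, E) ω G]

variable (E G) in
/-- The derivative at `1` of the left translation by the point with coordinates `x`. -/
noncomputable def chartLeftDeriv (x : E) : E →L[ℂ] E :=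
  (ContinuousLinearMap.compL ℂ E (E × E) E).flip (ContinuousLinearMap.inr ℂ E E)
    (fderiv ℂ (chartMul E G) (x, unitChart E G 1))

variable (E G) in
/-- The derivative at `1` of the right translation by the point with coordinates `x`. -/
noncomputable def chartRightDeriv (x : E) : E →L[ℂ] E :=
  (ContinuousLinearMap.compL ℂ E (E × E) E).flip (ContinuousLinearMap.inl ℂ E E)
    (fderiv ℂ (chartMul E G) (unitChart E G 1, x))

variable (E G) in
/-- The second derivative of the multiplication at `(1, 1)`, in the chart at `1`. -/
noncomputable def chartMulSnd : E × E →L[ℂ] E × E →L[ℂ] E :=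
  fderiv ℂ (fderiv ℂ (chartMul E G)) (unitChart E G 1, unitChart E G 1)

variable (E G) in
/-- The commutator of the second derivative of the multiplication; see `lie_eq_chartAd`. -/
noncomputable def chartAd : E →L[ℂ] E →L[ℂ] E :=
  ((ContinuousLinearMap.compL ℂ E (E × E) E).flip (ContinuousLinearMap.inr ℂ E E)).comp
      ((chartMulSnd E G).comp (ContinuousLinearMap.inl ℂ E E)) -
    ((ContinuousLinearMap.compL ℂ E (E × E) E).flip (ContinuousLinearMap.inl ℂ E E)).comp
      ((chartMulSnd E G).comp (ContinuousLinearMap.inr ℂ E E))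

omit [LieGroup 𝓘(ℂ, E) ω G] in
theorem chartAd_apply (v w : E) :
    chartAd E G v w = chartMulSnd E G (v, 0) (0, w) - chartMulSnd E G (0, v) (w, 0) := by
  simp [chartAd]

theorem chartMulSnd_symm (p q : E × E) : chartMulSnd E G p q = chartMulSnd E G q p :=
  (contDiffAt_chartMul_left (E := E) (G := G) chart_one_mem_target).isSymmSndFDerivAt_of_omega p q

theorem hasFDerivAt_fderiv_chartMul : HasFDerivAt (fderiv ℂ (chartMul E G)) (chartMulSnd E G)
    (unitChart E G 1, unitChart E G 1) :=
  (((contDiffAt_chartMul_left chart_one_mem_target).fderiv_right (m := 1)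
    (by simp)).differentiableAt (by simp)).hasFDerivAt

theorem hasFDerivAt_chartMul_left {x : E} (hx : x ∈ (unitChart E G).target) :
    HasFDerivAt (fun z => chartMul E G (x, z)) (chartLeftDeriv E G x) (unitChart E G 1) :=
  ((contDiffAt_chartMul_left hx).differentiableAt (by simp)).hasFDerivAt.comp
    (f := fun z => (x, z)) (unitChart E G 1) (hasFDerivAt_prodMk_right (𝕜 := ℂ) x (unitChart E G 1))

theorem hasFDerivAt_chartMul_right {x : E} (hx : x ∈ (unitChart E G).target) :
    HasFDerivAt (fun z => chartMul E G (z, x)) (chartRightDeriv E G x) (unitChart E G 1) :=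
  ((contDiffAt_chartMul_right hx).differentiableAt (by simp)).hasFDerivAt.comp
    (f := fun z => (z, x)) (unitChart E G 1) (hasFDerivAt_prodMk_left (𝕜 := ℂ) (unitChart E G 1) x)

theorem chartLeftDeriv_one : chartLeftDeriv E G (unitChart E G 1) = 1 :=
  (hasFDerivAt_chartMul_left chart_one_mem_target).unique
    ((hasFDerivAt_id _).congr_of_eventuallyEq eventually_chartMul_one_left)

theorem chartRightDeriv_one : chartRightDeriv E G (unitChart E G 1) = 1 :=
  (hasFDerivAt_chartMul_right chart_one_mem_target).unique
    ((hasFDerivAt_id _).congr_of_eventuallyEq eventually_chartMul_one_right)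

theorem hasFDerivAt_chartLeftDeriv : HasFDerivAt (chartLeftDeriv E G)
    (((ContinuousLinearMap.compL ℂ E (E × E) E).flip (ContinuousLinearMap.inr ℂ E E)).comp
      ((chartMulSnd E G).comp (ContinuousLinearMap.inl ℂ E E))) (unitChart E G 1) :=
  (ContinuousLinearMap.hasFDerivAt _).comp _ (hasFDerivAt_fderiv_chartMul.comp
    (f := fun z => (z, unitChart E G 1)) (unitChart E G 1)
    (hasFDerivAt_prodMk_left (𝕜 := ℂ) (unitChart E G 1) (unitChart E G 1)))

theorem hasFDerivAt_chartRightDeriv : HasFDerivAt (chartRightDeriv E G)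
    (((ContinuousLinearMap.compL ℂ E (E × E) E).flip (ContinuousLinearMap.inl ℂ E E)).comp
      ((chartMulSnd E G).comp (ContinuousLinearMap.inr ℂ E E))) (unitChart E G 1) :=
  (ContinuousLinearMap.hasFDerivAt _).comp _ (hasFDerivAt_fderiv_chartMul.comp
    (f := fun z => (unitChart E G 1, z)) (unitChart E G 1)
    (hasFDerivAt_prodMk_right (𝕜 := ℂ) (unitChart E G 1) (unitChart E G 1)))

/-- Differentiate `g z = (g z g⁻¹) g` at `z = 1`. -/
theorem chartLeftDeriv_eq {x : E} (hx : x ∈ (unitChart E G).target) :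
    chartLeftDeriv E G x = chartRightDeriv E G x * lieAd E ((unitChart E G).symm x) := by
  have h1 := (HasUnitDeriv.chart_symm (E := E) (G := G)).conj ((unitChart E G).symm x)
  have h2 : HasFDerivAt (fun z => chartMul E G (z, x)) (chartRightDeriv E G x)
      (unitChart E G ((unitChart E G).symm x * (unitChart E G).symm (unitChart E G 1) *
        ((unitChart E G).symm x)⁻¹)) := by
    rw [h1.eq_one]; exact hasFDerivAt_chartMul_right hx
  refine (hasFDerivAt_chartMul_left hx).unique
    ((h2.comp (unitChart E G 1) h1.hasFDerivAt).congr_of_eventuallyEq ?_)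
  filter_upwards [h1.eventually_mem_source] with z hz
  simp only [Function.comp_apply, chartMul, (unitChart E G).left_inv hz, inv_mul_cancel_right]

theorem hasFDerivAt_lieAd [CompleteSpace E] :
    HasFDerivAt (fun x => lieAd E ((unitChart E G).symm x)) (chartAd E G) (unitChart E G 1) := by
  refine hasFDerivAt_of_eventually_eq_mul hasFDerivAt_chartLeftDeriv hasFDerivAt_chartRightDeriv
    chartLeftDeriv_one chartRightDeriv_one ?_
  filter_upwards [(unitChart E G).open_target.mem_nhds chart_one_mem_target] with x hx
  exact chartLeftDeriv_eq hx

/-- `Ad ∘ γ` is multiplicative, so its derivative at `0` determines the derivative at every `t`. -/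
theorem HasLogDeriv.hasDerivAt_lieAd [CompleteSpace E] {γ : ℂ → G} {v : E} (h0 : γ 0 = 1)
    (h : ∀ t, HasLogDeriv γ v t) (t : ℂ) :
    HasDerivAt (fun s => lieAd E (γ s)) (lieAd E (γ t) * chartAd E G v) t := by
  have h1 : HasUnitDeriv γ (ContinuousLinearMap.toSpanSingleton ℂ v) 0 :=
    HasUnitDeriv.congr (h 0) (Eventually.of_forall fun x => by simp [h0])
  have h2 : HasDerivAt (fun s => lieAd E (γ s)) (chartAd E G v) 0 := by
    have hA := hasFDerivAt_lieAd (E := E) (G := G)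
    rw [← h1.eq_one] at hA
    have := hA.comp_hasDerivAt (0 : ℂ) (by simpa using h1.hasFDerivAt.hasDerivAt)
    refine this.congr_of_eventuallyEq ?_
    filter_upwards [h1.eventually_mem_source] with s hs
    simp only [Function.comp_apply, (unitChart E G).left_inv hs]
  have h3 : HasDerivAt (fun s => lieAd E (γ (s - t))) (chartAd E G v) t := by
    refine HasDerivAt.comp_sub_const (f := fun s => lieAd E (γ s)) t t ?_
    rw [sub_self]; exact h2
  refine ((hasDerivAt_const t (lieAd E (γ t))).mul h3).congr_deriv (by simp) |>.congr_of_eventuallyEq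
    (Eventually.of_forall fun s => ?_)
  simp only [Pi.mul_apply, ← lieAd_mul, ← HasLogDeriv.map_add h0 h, add_sub_cancel]

theorem HasLogDeriv.lieAd_eq_exp [CompleteSpace E] {γ : ℂ → G} {v : E} (h0 : γ 0 = 1)
    (h : ∀ t, HasLogDeriv γ v t) (t : ℂ) :
    lieAd E (γ t) = NormedSpace.exp (t • chartAd E G v) := by
  refine eq_of_same_logDeriv (W := fun _ => chartAd E G v)
    (R' := fun t => NormedSpace.exp ((-t) • chartAd E G v)) (R := fun t => NormedSpace.exp (t • chartAd E G v))
    (HasLogDeriv.hasDerivAt_lieAd h0 h) (fun t => ?_) (fun t => ?_) ?_ t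
  · exact (hasDerivAt_exp_smul_comp' (A := E →L[ℂ] E) (hasDerivAt_neg t) (chartAd E G v)).congr_deriv
      (neg_one_smul ℂ _)
  · simpa using exp_neg_smul_mul_exp_smul (chartAd E G v) t
  · simp [h0, lieAd_one]

end Adjoint

/-! ### The Lie bracket as a second derivative of the multiplication -/

section Bracket

open Filter VectorField

variable {E : Type*} [NormedAddCommGroup E] [NormedSpace ℂ E]
  {G : Type*} [TopologicalSpace G] [ChartedSpace E G] [Group G]

theorem MDifferentiableAt.hasFDerivAt_comp_chart_symm {F : G → E}
    (h : MDifferentiableAt 𝓘(ℂ, E) 𝓘(ℂ, E) F 1) {D : E →L[ℂ] E}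
    (hD : D = mfderiv 𝓘(ℂ, E) 𝓘(ℂ, E) F 1) :
    HasFDerivAt (fun x => F ((unitChart E G).symm x)) D (unitChart E G 1) := by
  have hd : HasFDerivWithinAt (writtenInExtChartAt 𝓘(ℂ, E) 𝓘(ℂ, E) 1 F)
    D (Set.range 𝓘(ℂ, E)) (extChartAt 𝓘(ℂ, E) (1 : G) 1) := hD ▸ h.hasMFDerivAt.2
  have e : writtenInExtChartAt 𝓘(ℂ, E) 𝓘(ℂ, E) 1 F = fun x => F ((unitChart E G).symm x) := by
    ext x
    simp only [writtenInExtChartAt, mfld_simps]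
    rfl
  rw [e, ModelWithCorners.range_eq_univ, hasFDerivWithinAt_univ] at hd
  exact hd

variable [LieGroup 𝓘(ℂ, E) ω G]

theorem mfderiv_chart_comp_mul_left {x : E} (hx : x ∈ (unitChart E G).target) (v : E) :
    (mfderiv 𝓘(ℂ, E) 𝓘(ℂ, E) (unitChart E G) ((unitChart E G).symm x)
      (mulInvariantVectorField (I := 𝓘(ℂ, E)) (v : GroupLieAlgebra 𝓘(ℂ, E) G)
        ((unitChart E G).symm x)) : E) = chartLeftDeriv E G x v := by
  set g := (unitChart E G).symm x with hg
  have hgs : g ∈ (unitChart E G).source := (unitChart E G).map_target hx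
  have h1 : MDifferentiableAt 𝓘(ℂ, E) 𝓘(ℂ, E) (unitChart E G) (g * 1) := by
    rw [mul_one]
    exact (contMDiffOn_chart.contMDiffAt ((unitChart E G).open_source.mem_nhds hgs)).mdifferentiableAt
      (n := ω) (by simp)
  have h2 : MDifferentiableAt 𝓘(ℂ, E) 𝓘(ℂ, E) (fun y : G => g * y) 1 :=
    (contMDiff_mul_left (n := ω)).contMDiffAt.mdifferentiableAt (by simp)
  obtain ⟨D, hD⟩ : ∃ D : E →L[ℂ] E, D = mfderiv 𝓘(ℂ, E) 𝓘(ℂ, E) (fun y : G => unitChart E G (g * y)) 1 :=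
    ⟨_, rfl⟩
  have h3 := MDifferentiableAt.hasFDerivAt_comp_chart_symm (h1.comp (1 : G) h2) hD
  have h4 : D = chartLeftDeriv E G x := h3.unique (hasFDerivAt_chartMul_left hx)
  rw [← h4]
  have h5 := mfderiv_comp (1 : G) h1 h2
  have h6 := hD.trans h5
  rw [h6]
  have : ∀ g' : G, g' = g * 1 → (mfderiv 𝓘(ℂ, E) 𝓘(ℂ, E) (unitChart E G) g' : E →L[ℂ] E) =
      (mfderiv 𝓘(ℂ, E) 𝓘(ℂ, E) (unitChart E G) (g * 1) : E →L[ℂ] E) := fun g' h => by subst h; rfl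
  exact congrArg (fun L : E →L[ℂ] E => L _) (this g (mul_one g).symm)

theorem mpullbackWithin_mulInvariantVectorField {x : E} (hx : x ∈ (unitChart E G).target) (v : E) :
    (mpullbackWithin 𝓘(ℂ, E) 𝓘(ℂ, E) (extChartAt 𝓘(ℂ, E) (1 : G)).symm
      (mulInvariantVectorField (v : GroupLieAlgebra 𝓘(ℂ, E) G)) (Set.range 𝓘(ℂ, E)) x : E) =
    chartLeftDeriv E G x v := by
  have hx' : x ∈ (extChartAt 𝓘(ℂ, E) (1 : G)).target := by simpa using hx
  rw [mpullbackWithin_apply, ContinuousLinearMap.inverse_eq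
    (mfderivWithin_extChartAt_symm_comp_mfderiv_extChartAt hx')
    (mfderiv_extChartAt_comp_mfderivWithin_extChartAt_symm hx'), ← mfderiv_chart_comp_mul_left hx]
  rfl

/-- In the chart the left-invariant fields are `x ↦ L(x) v`, with `L(1) = 1` and `L'(1)` the mixed
second derivative of the multiplication. Their bracket at `1` is `L'(1)(v) w - L'(1)(w) v`; symmetry
of the second derivative gives `chartAd`. -/
theorem lie_eq_chartAd (v w : GroupLieAlgebra 𝓘(ℂ, E) G) : ⁅v, w⁆ = chartAd E G v w := by
  obtain ⟨V, hV⟩ : ∃ V : E → E → E, V = fun v x =>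
      (mpullbackWithin 𝓘(ℂ, E) 𝓘(ℂ, E) (extChartAt 𝓘(ℂ, E) (1 : G)).symm
        (mulInvariantVectorField (v : GroupLieAlgebra 𝓘(ℂ, E) G)) (Set.range 𝓘(ℂ, E)) x : E) :=
    ⟨_, rfl⟩
  have key : ∀ v : E, V v =ᶠ[𝓝 (unitChart E G 1)] fun x => chartLeftDeriv E G x v := fun v => by
    filter_upwards [(unitChart E G).open_target.mem_nhds chart_one_mem_target] with x hx
    rw [hV]
    exact mpullbackWithin_mulInvariantVectorField hx v
  have hder : ∀ v u : E, fderiv ℂ (fun x => chartLeftDeriv E G x v) (unitChart E G 1) u =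
      chartMulSnd E G (u, 0) (0, v) := fun v u => by
    rw [((hasFDerivAt_chartLeftDeriv (E := E) (G := G)).clm_apply (hasFDerivAt_const v _)).fderiv]
    simp
  have h1 : ∀ v w : E, lieBracket ℂ (fun x => chartLeftDeriv E G x v)
      (fun x => chartLeftDeriv E G x w) (unitChart E G 1) = chartAd E G v w := fun v w => by
    rw [lieBracket, hder, hder, chartLeftDeriv_one, chartAd_apply, chartMulSnd_symm (0, v)]
    rfl
  obtain ⟨D, hD⟩ : ∃ D : E →L[ℂ] E, D = mfderiv 𝓘(ℂ, E) 𝓘(ℂ, E) (extChartAt 𝓘(ℂ, E) (1 : G)) 1 :=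
    ⟨_, rfl⟩
  have hD1 : D.inverse = ContinuousLinearMap.id ℂ E := by
    rw [hD.trans mfderiv_extChartAt_self]
    exact ContinuousLinearMap.inverse_id
  have h2 : ⁅v, w⁆ = D.inverse (lieBracketWithin ℂ (V v) (V w)
      ((extChartAt 𝓘(ℂ, E) (1 : G)).symm ⁻¹' Set.univ ∩ Set.range 𝓘(ℂ, E)) (unitChart E G 1)) := by
    rw [hD, hV]; rfl
  rw [hD1, Set.preimage_univ, Set.univ_inter, ModelWithCorners.range_eq_univ,
    lieBracketWithin_univ] at h2
  exact h2.trans (((key v).lieBracket_vectorField_eq (key w)).trans (h1 v w))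

end Bracket

/-! ### The `𝔰𝔩₂`-triple under the adjoint representation -/

section Sl2InLieGroup

open Filter

variable {E : Type*} [NormedAddCommGroup E] [NormedSpace ℂ E]
  {G : Type*} [TopologicalSpace G] [ChartedSpace E G] [Group G] [LieGroup 𝓘(ℂ, E) ω G]

theorem lieAd_lieExp [CompleteSpace E] (v : E) :
    lieAd E (lieExp (E := E) (G := G) v) = NormedSpace.exp (chartAd E G v) := by
  obtain ⟨γ, h0, h⟩ := exists_hasLogDeriv G v
  rw [lieExp_eq h0 h, HasLogDeriv.lieAd_eq_exp h0 h, one_smul]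

/-- The Jacobi identity, rewritten for `chartAd`. -/
theorem chartAd_lie [CompleteSpace E] (v w : GroupLieAlgebra 𝓘(ℂ, E) G) :
    chartAd E G (⁅v, w⁆ : GroupLieAlgebra 𝓘(ℂ, E) G) =
      chartAd E G v * chartAd E G w - chartAd E G w * chartAd E G v := by
  have key : ∀ u : GroupLieAlgebra 𝓘(ℂ, E) G,
      chartAd E G (⁅v, w⁆ : GroupLieAlgebra 𝓘(ℂ, E) G) u =
      (chartAd E G v * chartAd E G w - chartAd E G w * chartAd E G v) u := fun u => by
    refine (lie_eq_chartAd ⁅v, w⁆ u).symm.trans ((lie_lie v w u).trans ?_)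
    rw [lie_eq_chartAd v, lie_eq_chartAd w u, lie_eq_chartAd w, lie_eq_chartAd v u]
    rfl
  exact ContinuousLinearMap.ext key

theorem IsSl2Triple.sl2Relations_chartAd [CompleteSpace E] {h e f : GroupLieAlgebra 𝓘(ℂ, E) G}
    (t : IsSl2Triple h e f) : Sl2Relations (chartAd E G h) (chartAd E G e) (chartAd E G f) where
  hx := by
    rw [← chartAd_lie, t.lie_h_e_nsmul, two_nsmul, two_smul]
    exact map_add (chartAd E G) e e
  hy := by
    rw [← chartAd_lie, t.lie_h_f_nsmul, neg_smul, two_nsmul, two_smul]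
    exact (map_neg (chartAd E G) _).trans (congrArg Neg.neg (map_add (chartAd E G) f f))
  xy := by rw [← chartAd_lie, t.lie_e_f]

theorem isIntegerDiagonalizable_chartAd [CompleteSpace E] {h : GroupLieAlgebra 𝓘(ℂ, E) G}
    (hh : Submodule.span ℂ {v : GroupLieAlgebra 𝓘(ℂ, E) G | ∃ j : ℤ, ⁅h, v⁆ = (j : ℂ) • v} = ⊤) :
    IsIntegerDiagonalizable (chartAd E G h) := by
  simp only [lie_eq_chartAd] at hh
  exact hh

theorem endTrace_chartAd [CompleteSpace E] (h : GroupLieAlgebra 𝓘(ℂ, E) G) :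
    ContinuousLinearMap.endTrace (chartAd E G h * chartAd E G h) =
      LinearMap.trace ℂ (GroupLieAlgebra 𝓘(ℂ, E) G)
        (LieAlgebra.ad ℂ _ h * LieAlgebra.ad ℂ _ h) := by
  have : LieAlgebra.ad ℂ (GroupLieAlgebra 𝓘(ℂ, E) G) h * LieAlgebra.ad ℂ _ h =
      ((chartAd E G h * chartAd E G h : E →L[ℂ] E) : E →ₗ[ℂ] E) := by
    refine LinearMap.ext fun v => ?_
    change ⁅h, ⁅h, v⁆⁆ = _
    rw [lie_eq_chartAd h, lie_eq_chartAd h v]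
    rfl
  rw [this]
  rfl

variable (E G) in
theorem exists_isSl2Triple_groupLieAlgebra [CompleteSpace E] [FiniteDimensional ℂ E] [Nontrivial E]
    [LieAlgebra.IsSemisimple ℂ (GroupLieAlgebra 𝓘(ℂ, E) G)] :
    ∃ h e f : GroupLieAlgebra 𝓘(ℂ, E) G, IsSl2Triple h e f ∧
      IsIntegerDiagonalizable (chartAd E G h) ∧
      ContinuousLinearMap.endTrace (chartAd E G h * chartAd E G h) ≠ 0 := by
  have : Module.Finite ℂ (GroupLieAlgebra 𝓘(ℂ, E) G) := inferInstanceAs (Module.Finite ℂ E)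
  have : Nontrivial (GroupLieAlgebra 𝓘(ℂ, E) G) := inferInstanceAs (Nontrivial E)
  obtain ⟨h, e, f, t, hd, htr⟩ :=
    LieAlgebra.exists_isSl2Triple_of_isSemisimple (GroupLieAlgebra 𝓘(ℂ, E) G)
  refine ⟨h, e, f, t, isIntegerDiagonalizable_chartAd hd, ?_⟩
  rw [endTrace_chartAd]
  exact htr

end Sl2InLieGroup

/-! ### Loops close to the identity without logarithm -/

section Loops

open Filter

/-- A jointly continuous family is a continuous curve in the compact-open topology; let its
parameter tend to `0`. -/
theorem tendsto_curry_one_div {Z N : Type*} [TopologicalSpace Z] [TopologicalSpace N]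
    (Φ : C(ℂ × Z, N)) {f : ℕ → C(Z, N)} (hf : ∀ n z, f n z = Φ (1 / ((n : ℂ) + 1), z))
    {g : C(Z, N)} (hg : ∀ z, g z = Φ (0, z)) : Tendsto f atTop (𝓝 g) := by
  have e1 : f = fun n : ℕ => Φ.curry (1 / ((n : ℂ) + 1)) := by
    ext n z; exact hf n z
  have e2 : g = Φ.curry 0 := by ext z; exact hg z
  rw [e1, e2]
  have h : Tendsto (fun n : ℕ => 1 / ((n : ℂ) + 1)) atTop (𝓝 0) :=
    tendsto_one_div_add_atTop_nhds_zero_nat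
  exact (Φ.curry.continuous.tendsto 0).comp h

variable {E : Type*} [NormedAddCommGroup E] [NormedSpace ℂ E]
  {G : Type*} [TopologicalSpace G] [ChartedSpace E G] [Group G] [LieGroup 𝓘(ℂ, E) ω G]

omit [LieGroup 𝓘(ℂ, E) ω G] in
theorem HolLoop.tendsto_one {Φ : ℂ × ℂˣ → G} (hΦ : Continuous Φ) (h0 : ∀ z, Φ (0, z) = 1)
    {f : ℕ → HolLoop E G} (hf : ∀ n z, f n z = Φ (1 / ((n : ℂ) + 1), z)) :
    Tendsto f atTop (𝓝 1) := by
  have hi : Topology.IsInducing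
    (fun f : HolLoop E G => (⟨f, f.contMDiff.continuous⟩ : C(ℂˣ, G))) := ⟨rfl⟩
  rw [hi.tendsto_nhds_iff]
  exact tendsto_curry_one_div ⟨Φ, hΦ⟩ hf fun z => (h0 z).symm

/-- The loops `z ↦ γ(s) δ(s (z - 1))`. -/
noncomputable def HolLoop.mulShift {γ δ : ℂ → G} (hδ : ContMDiff 𝓘(ℂ, ℂ) 𝓘(ℂ, E) ω δ) (s : ℂ) :
    HolLoop E G :=
  ⟨fun z => γ s * δ (s * ((z : ℂ) - 1)), contMDiff_const.mul (hδ.comp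
    ((contDiff_const.mul (contDiff_id.sub contDiff_const)).contMDiff.comp Units.contMDiff_val))⟩

theorem Mexp_ne_mulShift [CompleteSpace E] [FiniteDimensional ℂ E]
    {h e f : GroupLieAlgebra 𝓘(ℂ, E) G} (t : IsSl2Triple h e f)
    (hd : IsIntegerDiagonalizable (chartAd E G h))
    (htr : ContinuousLinearMap.endTrace (chartAd E G h * chartAd E G h) ≠ 0)
    {γ δ : ℂ → G} (hγ0 : γ 0 = 1) (hγ : ∀ t, HasLogDeriv (E := E) γ e t)
    (hδ0 : δ 0 = 1) (hδ : ∀ t, HasLogDeriv (E := E) δ f t) {s : ℝ} (hs0 : 0 < s) (hs1 : s ≤ 1)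
    (X : HolLoop E E) {F : ℂˣ → G} (hF : ∀ z : ℂˣ, F z = γ s * δ (s * ((z : ℂ) - 1))) :
    Mexp X ≠ F := by
  intro hX
  -- The value at `0` plays no role: continuity and the logarithm equation are needed only off `0`.
  let A : ℂ → E →L[ℂ] E := fun z => if hz : z = 0 then 0 else chartAd E G (X (Units.mk0 z hz))
  have hA : ∀ z (hz : z ≠ 0), A z = chartAd E G (X (Units.mk0 z hz)) := fun z hz => dif_neg hz
  refine t.sl2Relations_chartAd.not_exists_log hd htr hs0 hs1 (A := A) ?_ fun z hz => ?_
  · rw [continuousOn_iff_continuous_domRestrict]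
    have hc : Continuous fun z : ({0}ᶜ : Set ℂ) => Units.mk0 (z : ℂ) z.2 :=
      Units.isEmbedding_val₀.continuous_iff.2 continuous_subtype_val
    refine ((chartAd E G).continuous.comp (X.contMDiff.continuous.comp hc)).congr fun z => ?_
    exact (hA z z.2).symm
  · have h1 := congrFun hX (Units.mk0 z hz)
    rw [hF] at h1
    rw [hA z hz, ← HasLogDeriv.lieAd_eq_exp hγ0 hγ, ← HasLogDeriv.lieAd_eq_exp hδ0 hδ, ← lieAd_mul,
      ← lieAd_lieExp]
    exact congrArg (lieAd E) h1

end Loops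

/-! ### Entire curves in the identity component -/

section IdentityComponent

open Filter

variable (E : Type*) [NormedAddCommGroup E] [NormedSpace ℂ E]
  (G : Type*) [TopologicalSpace G] [ChartedSpace E G] [Group G] [LieGroup 𝓘(ℂ, E) ω G]

/-- The subgroup of all elements that can be joined to `1` by an entire curve. -/
def entireCurveSubgroup : Subgroup G where
  carrier := {g | ∃ F : ℂ → G, ContMDiff 𝓘(ℂ, ℂ) 𝓘(ℂ, E) ω F ∧ F 0 = 1 ∧ F 1 = g}
  mul_mem' := by
    rintro _ _ ⟨F, hF, hF0, rfl⟩ ⟨F', hF', hF'0, rfl⟩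
    exact ⟨fun t => F t * F' t, hF.mul hF', by simp [hF0, hF'0], rfl⟩
  one_mem' := ⟨fun _ => 1, contMDiff_const, rfl, rfl⟩
  inv_mem' := by
    rintro _ ⟨F, hF, hF0, rfl⟩
    exact ⟨fun t => (F t)⁻¹, hF.inv, by simp [hF0], rfl⟩

variable {E G}

theorem hasUnitDeriv_list_prod {W ι : Type*} [NormedAddCommGroup W] [NormedSpace ℂ W]
    {u : ι → W → G} {A : ι → W →L[ℂ] E} {w : W} (h : ∀ i, HasUnitDeriv (u i) (A i) w) (l : List ι) :
    HasUnitDeriv (fun x => (l.map fun i => u i x).prod) (l.map A).sum w := by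
  induction l with
  | nil => simpa using HasUnitDeriv.one
  | cons i l ih => simpa using (h i).mul ih

theorem contMDiff_list_prod' {W ι : Type*} [NormedAddCommGroup W] [NormedSpace ℂ W]
    {u : ι → W → G} (h : ∀ i, ContMDiff 𝓘(ℂ, W) 𝓘(ℂ, E) ω (u i)) (l : List ι) :
    ContMDiff 𝓘(ℂ, W) 𝓘(ℂ, E) ω (fun x => (l.map fun i => u i x).prod) := by
  induction l with
  | nil => simpa using contMDiff_const
  | cons i l ih =>
    simp only [List.map_cons, List.prod_cons]
    exact (h i).mul ih

/-- The inverse function theorem in the chart, transported back to the group. -/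
theorem HasUnitDeriv.map_nhds_eq [CompleteSpace E] {u : E → G} {w : E}
    (h : HasUnitDeriv u (ContinuousLinearMap.id ℂ E) w)
    (hu : ContMDiffAt 𝓘(ℂ, E) 𝓘(ℂ, E) ω u w) : Filter.map u (𝓝 w) = 𝓝 1 := by
  have hs : u w ∈ (unitChart E G).source := h.eq_one ▸ one_mem_chart_source
  have h1 : HasStrictFDerivAt (fun x => unitChart E G (u x))
      ((ContinuousLinearEquiv.refl ℂ E : E ≃L[ℂ] E) : E →L[ℂ] E) w :=
    (hu.contDiffAt_chart hs).hasStrictFDerivAt' h.hasFDerivAt (by simp)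
  have h2 := h1.map_nhds_eq_of_equiv
  rw [h.eq_one] at h2
  have h3 : u =ᶠ[𝓝 w] (unitChart E G).symm ∘ fun x => unitChart E G (u x) :=
    h.eventually_mem_source.mono fun x hx => ((unitChart E G).left_inv hx).symm
  rw [map_congr h3, ← map_map, h2, (unitChart E G).symm_map_nhds_eq one_mem_chart_source]

variable (E G) in
-- Coordinates of the second kind: the product of the one-parameter subgroups of a basis has the
-- identity as derivative at `0`.
theorem exists_contMDiff_map_nhds_eq [CompleteSpace E] [FiniteDimensional ℂ E] :
    ∃ Θ : E → G, ContMDiff 𝓘(ℂ, E) 𝓘(ℂ, E) ω Θ ∧ Θ 0 = 1 ∧ map Θ (𝓝 0) = 𝓝 1 := by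
  let b := Module.finBasis ℂ E
  choose γ h0 hγ using fun i => exists_hasLogDeriv G (b i)
  let φ : Fin (Module.finrank ℂ E) → E →L[ℂ] ℂ := fun i => LinearMap.toContinuousLinearMap (b.coord i)
  have h1 : ∀ i, HasUnitDeriv (fun x => γ i (φ i x))
      ((ContinuousLinearMap.toSpanSingleton ℂ (b i)).comp (φ i)) 0 := fun i =>
    (HasUnitDeriv.congr (hγ i 0) (Eventually.of_forall fun x => by simp [h0])).comp
      (φ i).hasFDerivAt (map_zero _)
  have h2 : ((Finset.univ.toList).map fun i =>
      (ContinuousLinearMap.toSpanSingleton ℂ (b i)).comp (φ i)).sum = ContinuousLinearMap.id ℂ E := by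
    rw [Finset.sum_map_toList]
    ext x
    simp [φ, sum_apply, b.sum_repr x]
  have h3 := hasUnitDeriv_list_prod h1 Finset.univ.toList
  rw [h2] at h3
  have h4 : ∀ i, ContMDiff 𝓘(ℂ, E) 𝓘(ℂ, E) ω (fun x => γ i (φ i x)) := fun i =>
    (HasLogDeriv.contMDiff (hγ i)).comp (φ i).contMDiff
  have h5 := contMDiff_list_prod' h4 Finset.univ.toList
  exact ⟨_, h5, h3.eq_one, h3.map_nhds_eq (h5 0)⟩

/-- The curves `t ↦ Θ(t x)` reach a neighbourhood of `1`, so the subgroup is open, hence clopen. -/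
theorem connectedComponent_subset_entireCurveSubgroup [CompleteSpace E] [FiniteDimensional ℂ E] :
    connectedComponent (1 : G) ⊆ entireCurveSubgroup E G := by
  have := topologicalGroup_of_lieGroup 𝓘(ℂ, E) ω (G := G)
  obtain ⟨Θ, hΘ, hΘ0, hmap⟩ := exists_contMDiff_map_nhds_eq E G
  have ho : IsOpen (entireCurveSubgroup E G : Set G) := by
    refine Subgroup.isOpen_of_mem_nhds (g := 1) _ ?_
    rw [← hmap]
    refine mem_of_superset (range_mem_map (f := 𝓝 0)) ?_
    rintro _ ⟨x, rfl⟩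
    exact ⟨fun t => Θ (t • x), hΘ.comp (contDiff_id.smul contDiff_const).contMDiff,
      by simp [hΘ0], by simp⟩
  exact IsClopen.connectedComponent_subset ⟨Subgroup.isClosed_of_isOpen _ ho, ho⟩ (one_mem _)

theorem exists_tendsto_one_of_mem_connectedComponent [CompleteSpace E] [FiniteDimensional ℂ E]
    {g : G} (hg : g ∈ connectedComponent (1 : G)) :
    ∃ f : ℕ → HolLoop E G, Tendsto f atTop (𝓝 1) ∧ ∀ n, ∃ z, f n z = g := by
  obtain ⟨F, hF, hF0, hF1⟩ := connectedComponent_subset_entireCurveSubgroup (E := E) hg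
  refine ⟨fun n => ⟨fun z => F (1 / ((n : ℂ) + 1) * z), hF.comp
    ((contDiff_const.mul contDiff_id).contMDiff.comp Units.contMDiff_val)⟩, ?_, fun n => ?_⟩
  · exact HolLoop.tendsto_one (Φ := fun p => F (p.1 * p.2))
      (hF.continuous.comp (continuous_fst.mul (Units.continuous_val.comp continuous_snd)))
      (fun z => by simp [hF0]) (fun n z => rfl)
  · have hn : (n : ℂ) + 1 ≠ 0 := Nat.cast_add_one_ne_zero n
    refine ⟨Units.mk0 _ hn, ?_⟩
    change F (1 / ((n : ℂ) + 1) * ((n : ℂ) + 1)) = g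
    rw [one_div_mul_cancel hn, hF1]

end IdentityComponent

/-! ### Explicit loops in `SL(2, ℂ)` -/

section SL2

open Filter Matrix

theorem Matrix.exp_eq_one_add_of_sq_eq_zero {A : Matrix (Fin 2) (Fin 2) ℂ} (h : A * A = 0) :
    NormedSpace.exp A = 1 + A := by
  rw [NormedSpace.exp_eq_tsum ℂ]
  dsimp only
  rw [tsum_eq_sum (s := Finset.range 2)]
  · simp [Finset.sum_range_succ]
  · intro k hk
    obtain ⟨m, rfl⟩ := Nat.exists_eq_add_of_le (not_lt.1 (Finset.mem_range.not.1 hk))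
    rw [pow_add, pow_two, h, zero_mul, smul_zero]

/-- `M + 1` is nilpotent and nonzero. A traceless logarithm commutes with it, so it is a multiple of
`M + 1` and squares to `0`; then `exp A = 1 + A` has trace `2`, not `-2`. -/
theorem Matrix.exp_ne_of_trace_eq_neg_two {A M : Matrix (Fin 2) (Fin 2) ℂ} (hA : A.trace = 0)
    (hM : M.trace = -2) (hdet : M.det = 1) (h01 : M 0 1 ≠ 0) : NormedSpace.exp A ≠ M := by
  intro h
  have hc : A * M = M * A := h ▸ (Commute.refl A).exp_right
  have h1 := congrFun (congrFun hc 0) 0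
  have h2 := congrFun (congrFun hc 0) 1
  simp only [Matrix.mul_apply, Fin.sum_univ_two, Matrix.trace_fin_two, Matrix.det_fin_two] at *
  have hsq : A * A = 0 := by
    have e1 : A 1 1 = -A 0 0 := by linear_combination hA
    have e2 : M 1 1 = -2 - M 0 0 := by linear_combination hM
    rw [e1, e2] at h2
    rw [e2] at hdet
    have e3 : A 0 0 * M 0 1 = A 0 1 * (M 0 0 + 1) := by linear_combination h2 / 2
    have e4 : A 0 0 * A 0 0 + A 0 1 * A 1 0 = 0 := by
      have : (A 0 0 * A 0 0 + A 0 1 * A 1 0) * M 0 1 ^ 2 = 0 := by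
        linear_combination (A 0 0 * M 0 1 + A 0 1 * (M 0 0 + 1)) * e3 - A 0 1 * M 0 1 * h1
          - A 0 1 ^ 2 * hdet
      exact (mul_eq_zero.1 this).resolve_right (pow_ne_zero 2 h01)
    ext i j
    fin_cases i <;> fin_cases j <;>
      simp only [Matrix.mul_apply, Fin.sum_univ_two, Fin.zero_eta, Fin.mk_one, Matrix.zero_apply, e1]
    · exact e4
    · ring
    · ring
    · linear_combination e4
  have h3 := Matrix.exp_eq_one_add_of_sq_eq_zero hsq
  rw [h] at h3
  rw [h3] at hM
  simp only [Matrix.add_apply, Matrix.one_apply_eq] at hM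
  have : (4 : ℂ) = 0 := by linear_combination hM - hA
  norm_num at this

/-- The family of loops `z ↦ (1, s; s (z - 1), 1 + s² (z - 1))` in `SL(2, ℂ)`. -/
noncomputable def slLoopFamily : C(ℂ × ℂˣ, Matrix.SpecialLinearGroup (Fin 2) ℂ) where
  toFun p := ⟨!![1, p.1; p.1 * ((p.2 : ℂ) - 1), 1 + p.1 ^ 2 * ((p.2 : ℂ) - 1)], by
    rw [Matrix.det_fin_two_of]; ring⟩
  continuous_toFun := by
    refine Continuous.subtype_mk (continuous_matrix fun i j => ?_) _
    have : Continuous fun p : ℂ × ℂˣ => (p.2 : ℂ) := Units.continuous_val.comp continuous_snd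
    fin_cases i <;> fin_cases j <;> simp <;> fun_prop

theorem slLoopFamily_apply (s : ℂ) (z : ℂˣ) : (slLoopFamily (s, z)).val =
    !![1, s; s * ((z : ℂ) - 1), 1 + s ^ 2 * ((z : ℂ) - 1)] := rfl

theorem exists_tendsto_one_specialLinearGroup : ∃ f : ℕ → C(ℂˣ, Matrix.SpecialLinearGroup (Fin 2) ℂ),
      (∀ n i j, ContMDiff 𝓘(ℂ, ℂ) 𝓘(ℂ, ℂ) ω (fun z : ℂˣ => (f n z).val i j)) ∧
      Filter.Tendsto f Filter.atTop (𝓝 1) ∧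
      ∀ n, ∃ z, ∀ A : Matrix (Fin 2) (Fin 2) ℂ, A.trace = 0 →
        NormedSpace.exp A ≠ (f n z).val := by
  refine ⟨fun n => slLoopFamily.curry (1 / ((n : ℂ) + 1)), fun n i j => ?_, ?_, fun n => ?_⟩
  · set s : ℂ := 1 / ((n : ℂ) + 1)
    have h1 : ContMDiff 𝓘(ℂ, ℂ) 𝓘(ℂ, ℂ) ω (fun z : ℂˣ => s * ((z : ℂ) - 1)) :=
      (contDiff_const.mul (contDiff_id.sub contDiff_const)).contMDiff.comp Units.contMDiff_val
    have h2 : ContMDiff 𝓘(ℂ, ℂ) 𝓘(ℂ, ℂ) ω (fun z : ℂˣ => 1 + s ^ 2 * ((z : ℂ) - 1)) :=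
      (contDiff_const.add (contDiff_const.mul (contDiff_id.sub contDiff_const))).contMDiff.comp
        Units.contMDiff_val
    fin_cases i <;> fin_cases j
    · exact contMDiff_const
    · exact contMDiff_const
    · exact h1
    · exact h2
  · refine tendsto_curry_one_div slLoopFamily (fun _ _ => rfl) fun z => Subtype.ext ?_
    rw [slLoopFamily_apply]
    ext i j
    fin_cases i <;> fin_cases j <;> simp
  · have hn : (n : ℂ) + 1 ≠ 0 := Nat.cast_add_one_ne_zero n
    -- With `s = 1/(n+1)`, this is the point `z = 1 - 4/s²` where the trace `2 + s² (z - 1)` equals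
    -- `-2`.
    have hz : 1 - 4 * ((n : ℂ) + 1) ^ 2 ≠ 0 := by
      have h2 : 4 * (n + 1) ^ 2 ≠ 1 := by omega
      intro h
      apply h2
      have : (4 * ((n : ℂ) + 1) ^ 2) = 1 := by linear_combination -h
      exact_mod_cast this
    refine ⟨Units.mk0 _ hz, fun A hA => ?_⟩
    rw [ContinuousMap.curry_apply]
    refine Matrix.exp_ne_of_trace_eq_neg_two hA ?_ (slLoopFamily _).property ?_
    · rw [slLoopFamily_apply, Matrix.trace_fin_two_of, Units.val_mk0]
      field_simp
      ring
    · rw [slLoopFamily_apply]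
      simpa using hn

end SL2

/-! ### Failure of local invertibility at `0` -/

section Main

open Filter

variable {E : Type*} [NormedAddCommGroup E] [NormedSpace ℂ E] [CompleteSpace E]
  {G : Type*} [TopologicalSpace G] [ChartedSpace E G] [Group G] [LieGroup 𝓘(ℂ, E) ω G]

theorem lieExp_zero : lieExp (E := E) (G := G) (0 : E) = 1 := by
  obtain ⟨γ, h0, h⟩ := exists_hasLogDeriv G (0 : E)
  rw [← h0, ← lieExp_smul_eq h0 h, zero_smul]

/-- The target of a local inverse is a neighbourhood of `Mexp 0 = 1` inside the image of `Mexp`, but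
some `f n` enters it. Only the homeomorphism is needed, not its smoothness. -/
theorem not_isLocalDiffeoAt_Mexp_zero {f : ℕ → HolLoop E G} (hf : Tendsto f atTop (𝓝 1))
    (hne : ∀ n, ∀ X : HolLoop E E, Mexp X ≠ ⇑(f n)) :
    ¬ HolLoop.IsLocalDiffeoAt (E' := E) (N' := G) (Mexp (E := E) (G := G)) (0 : HolLoop E E) := by
  rintro ⟨e, h0, he, -, -⟩
  have h1 : e 0 = 1 := by
    ext z
    rw [he 0 h0]
    exact lieExp_zero
  have h2 := hf.eventually (e.open_target.mem_nhds (h1 ▸ e.map_source h0))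
  obtain ⟨n, hn⟩ := h2.exists
  refine hne n (e.symm (f n)) ?_
  rw [← he _ (e.map_target hn), e.right_inv hn]

variable (E G) in
theorem exists_sl2_loops_tendsto_one [FiniteDimensional ℂ E] [Nontrivial E]
    [LieAlgebra.IsSemisimple ℂ (GroupLieAlgebra 𝓘(ℂ, E) G)] :
    ∃ 𝔥 : LieSubalgebra ℂ (GroupLieAlgebra 𝓘(ℂ, E) G),
      Nonempty (𝔥 ≃ₗ⁅ℂ⁆ LieAlgebra.SpecialLinear.sl (Fin 2) ℂ) ∧
      ∃ f : ℕ → HolLoop E G, Filter.Tendsto f Filter.atTop (𝓝 1) ∧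
        (∀ n z, f n z ∈ Subgroup.closure (lieExp '' (𝔥 : Set (GroupLieAlgebra 𝓘(ℂ, E) G)))) ∧
        ∀ n, ∀ X : HolLoop E E, Mexp X ≠ ⇑(f n) := by
  have := topologicalGroup_of_lieGroup 𝓘(ℂ, E) ω (G := G)
  obtain ⟨h, e, f, t, hd, htr⟩ := exists_isSl2Triple_groupLieAlgebra E G
  obtain ⟨γ, hγ0, hγ⟩ := exists_hasLogDeriv (E := E) G e
  obtain ⟨δ, hδ0, hδ⟩ := exists_hasLogDeriv (E := E) G f
  have he : e ∈ t.toLieSubalgebra ℂ := t.mem_toLieSubalgebra_iff.2 ⟨1, 0, 0, by simp⟩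
  have hf : f ∈ t.toLieSubalgebra ℂ := t.mem_toLieSubalgebra_iff.2 ⟨0, 1, 0, by simp⟩
  refine ⟨t.toLieSubalgebra ℂ, t.nonempty_equiv_sl,
    fun n => HolLoop.mulShift (γ := γ) (HasLogDeriv.contMDiff hδ) (1 / ((n : ℂ) + 1)), ?_, ?_, ?_⟩
  · refine HolLoop.tendsto_one (Φ := fun p => γ p.1 * δ (p.1 * ((p.2 : ℂ) - 1))) ?_ ?_
      (fun n z => rfl)
    · exact ((HasLogDeriv.contMDiff hγ).continuous.comp continuous_fst).mul
        ((HasLogDeriv.contMDiff hδ).continuous.comp (continuous_fst.mul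
          ((Units.continuous_val.comp continuous_snd).sub continuous_const)))
    · intro z
      simp [hγ0, hδ0]
  · intro n z
    refine mul_mem (Subgroup.subset_closure ?_) (Subgroup.subset_closure ?_)
    · rw [← lieExp_smul_eq hγ0 hγ]
      exact Set.mem_image_of_mem _ ((t.toLieSubalgebra ℂ).smul_mem _ he)
    · rw [← lieExp_smul_eq hδ0 hδ]
      exact Set.mem_image_of_mem _ ((t.toLieSubalgebra ℂ).smul_mem _ hf)
  · intro n X
    have hn : (0 : ℝ) < (n : ℝ) + 1 := Nat.cast_add_one_pos n
    refine Mexp_ne_mulShift t hd htr hγ0 hγ hδ0 hδ (s := 1 / ((n : ℝ) + 1)) (by positivity) ?_ X ?_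
    · rw [div_le_one hn]
      exact le_add_of_nonneg_left (Nat.cast_nonneg n)
    · intro z
      push_cast
      rfl

end Main
theorem mainTheorem10 {E : Type*} [NormedAddCommGroup E] [NormedSpace ℂ E] [CompleteSpace E]
    [FiniteDimensional ℂ E] [Nontrivial E]
    {G : Type*} [TopologicalSpace G] [ChartedSpace E G] [Group G] [LieGroup 𝓘(ℂ, E) ω G]
    [LieAlgebra.IsSemisimple ℂ (GroupLieAlgebra 𝓘(ℂ, E) G)] :
    -- `Mexp : M𝔤 → MG` is not a local diffeomorphism at `0`
    ¬ HolLoop.IsLocalDiffeoAt (E' := E) (N' := G) (Mexp (E := E) (G := G)) (0 : HolLoop E E) ∧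
    -- there are loops `f n → Id` in the connected subgroup `H` of `G` belonging to a subalgebra
    -- `𝔥 ≅ 𝔰𝔩(2, ℂ)`, none of which lies in the image of `Mexp`
    (∃ 𝔥 : LieSubalgebra ℂ (GroupLieAlgebra 𝓘(ℂ, E) G),
      Nonempty (𝔥 ≃ₗ⁅ℂ⁆ LieAlgebra.SpecialLinear.sl (Fin 2) ℂ) ∧
      ∃ f : ℕ → HolLoop E G, Filter.Tendsto f Filter.atTop (𝓝 1) ∧
        (∀ n z, f n z ∈ Subgroup.closure (lieExp '' (𝔥 : Set (GroupLieAlgebra 𝓘(ℂ, E) G)))) ∧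
        ∀ n, ∀ X : HolLoop E E, Mexp X ≠ ⇑(f n)) ∧
    -- if `exp` does not map onto the identity component, there are loops `f n → Id` that take
    -- values outside the image of `exp`
    ((∃ g ∈ connectedComponent (1 : G),
        g ∉ Set.range (lieExp : GroupLieAlgebra 𝓘(ℂ, E) G → G)) →
      ∃ f : ℕ → HolLoop E G, Filter.Tendsto f Filter.atTop (𝓝 1) ∧
        ∀ n, ∃ z, f n z ∉ Set.range (lieExp : GroupLieAlgebra 𝓘(ℂ, E) G → G)) ∧
    -- in `SL(2, ℂ)` there are loops `f n → Id` that take values outside the image of `exp`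
    (∃ f : ℕ → C(ℂˣ, Matrix.SpecialLinearGroup (Fin 2) ℂ),
      (∀ n i j, ContMDiff 𝓘(ℂ, ℂ) 𝓘(ℂ, ℂ) ω (fun z : ℂˣ => (f n z).val i j)) ∧
      Filter.Tendsto f Filter.atTop (𝓝 1) ∧
      ∀ n, ∃ z, ∀ A : Matrix (Fin 2) (Fin 2) ℂ, A.trace = 0 →
        NormedSpace.exp A ≠ (f n z).val) := by
  obtain ⟨𝔥, h𝔥, f, hf, hmem, hne⟩ := exists_sl2_loops_tendsto_one E G
  refine ⟨not_isLocalDiffeoAt_Mexp_zero hf hne, ⟨𝔥, h𝔥, f, hf, hmem, hne⟩, ?_,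
    exists_tendsto_one_specialLinearGroup⟩
  rintro ⟨g, hg, hg'⟩
  obtain ⟨f, hf, hfg⟩ := exists_tendsto_one_of_mem_connectedComponent (E := E) hg
  refine ⟨f, hf, fun n => ?_⟩
  obtain ⟨z, hz⟩ := hfg n
  exact ⟨z, hz ▸ hg'⟩
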